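/- Let $n\ge 1$, let $G=([n],E)$ be a connected simple graph, and for $\sigma\subseteq[n]$ let $G[\sigma]$ be the induced subgraph and $E(G[\sigma])$ its edge set. **Partial acyclic orientations.** Let $H$ be a simple graph on a finite vertex set $V$. A partition $\Sigma$ of $V$ is *connected* if every block induces a connected subgraph of $H$; the *partition graph* $H^\Sigma$ has vertex set $\Sigma$, two distinct blocks being adjacent iff some edge of $H$ joins them. A *partial acyclic orientation* (p.a.o.) $O$ of $H$ is a choice, for each edge of $H$, of one of its two directions or of "undirected", which arises from a connected partition $\Sigma$ and an acyclic orientation $O^\Sigma$ of $H^\Sigma$ (all edges directed, no directed cycle) by leaving the edges inside blocks undirected and directing each edge between two different blocks as $O^\Sigma$ directs the pair of blocks. The partition $\Sigma$ is determined by $O$. Put $\dim_H(O)=|V|-|\Sigma|$, and let $J_H(O)$ be the collection of all subsets of $V$ of the form $\bigcup_{\beta\in I}\beta$, where $I\subseteq\Sigma$ is an order ideal: if $\beta\in I$ and there is a directed path in $O^\Sigma$ from $\alpha$ to $\beta$, then $\alpha\in I$. **The abstract complex $\mathscr Y_G$.** Its cells are (1) the pairs $(\sigma,O)$ with $\emptyset\ne\sigma\subseteq[n]$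 and $O$ a p.a.o. of $G[\sigma]$, and (2) the subsets $\rho$ of $[n]$ with $\emptyset\neq\rho\neq[n]$. For cells $A\ne B$, $A\preceq B$ holds exactly in these cases: $A,B$ are both subsets and $A\subseteq B$; $A$ is a subset, $B=(\sigma,O)$ and $A\subseteq[n]\setminus\sigma$; $A=(\sigma_0,O_0)$, $B=(\sigma_1,O_1)$ and $J_{G[\sigma_1]}(O_1)\subseteq J_{G[\sigma_0]}(O_0)$ as collections of subsets of $[n]$. Also $A\preceq A$ for every cell $A$. The dimension is $\dim(\rho)=|\rho|-1$ and $\dim(\sigma,O)=|[n]\setminus\sigma|+\dim_{G[\sigma]}(O)$. **The geometric complex $\mathcal Y_G$.** The *clean graphical zonotope* of $G$ is $$Z=\Big\{x\in\mathbb R^{n}:\ \sum_{i\in[n]}x_i=n+|E|,\ \ \sum_{i\in\sigma}x_i\ge|\sigma|+|E(G[\sigma])|\ \text{ for all }\sigma\subseteq[n]\Big\}.$$ Let $N>0$ be real with $N\neq n+|E|$, let $N\Delta=\mathrm{conv}\{Ne_1,\dots,Ne_n\}$, and let $[Z,N\Delta]=\{\alpha s+(1-\alpha)t:\ \alpha\in[0,1],\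 s\in Z,\ t\in N\Delta\}$ be their join. Let $\mathcal Y_G$ be the collection of all nonempty faces of $[Z,N\Delta]$ other than $[Z,N\Delta]$ itself and $N\Delta$. **Theorem.** The join $[Z,N\Delta]$ is an $n$-dimensional polytope and $N\Delta$ is an $(n-1)$-dimensional face of it. $\mathscr Y_G$ is an abstract cell complex, i.e. $\preceq$ is a partial order and $\dim A<\dim B$ whenever $A\preceq B$, $A\ne B$. Finally, $\mathcal Y_G$ is a polytopal complex (a finite collection of nonempty polytopes, containing with each polytope all its nonempty faces, and such that any two members with nonempty intersection meet in a common face of both), and it realizes $\mathscr Y_G$: there is a bijection $f$ from the cells of $\mathscr Y_G$ onto $\mathcal Y_G$ such that $A\preceq B$ if and only if $f(A)\subseteq f(B)$, and the affine dimension of $f(A)$ equals $\dim(A)$, for all cells $A,B$. -/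

import Mathlib

open scoped BigOperators

noncomputable section

namespace GraphZono

/-! ### Partial acyclic orientations -/

/-- An orientation of a simple graph, in which each edge `{u, v}` is either given one of its two
directions or left undirected. `arc u v` says that the edge `{u, v}` is sent to `(u, v)`; an edge
with neither `arc u v` nor `arc v u` is left undirected (it is sent to itself). -/
@[ext]
structure GOrientation {V : Type*} (G : SimpleGraph V) where
  arc : V → V → Prop
  adj_of_arc : ∀ u v, arc u v → G.Adj u v
  asymm : ∀ u v, arc u v → ¬ arc v u

/-- An acyclic orientation: every edge receives a direction and there is no directed cycle. -/
def GOrientation.IsAcyclic {V : Type*} {G : SimpleGraph V} (O : GOrientation G) : Prop :=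
  (∀ u v, G.Adj u v → O.arc u v ∨ O.arc v u) ∧ ∀ v, ¬ Relation.TransGen O.arc v v

/-- A partition of the vertex set (given as an equivalence relation, its blocks being the
classes) is a connected partition of `G` if each block induces a connected subgraph. -/
def IsConnectedPartition {V : Type*} (G : SimpleGraph V) (r : Setoid V) : Prop :=
  ∀ c : Quotient r, (G.induce {v | Quotient.mk r v = c}).Connected

/-- The partition graph: its vertices are the blocks, and two distinct blocks are adjacent
when some edge of `G` joins them. -/
def partitionGraph {V : Type*} (G : SimpleGraph V) (r : Setoid V) :
    SimpleGraph (Quotient r) where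
  Adj a b := a ≠ b ∧ ∃ u v, Quotient.mk r u = a ∧ Quotient.mk r v = b ∧ G.Adj u v
  symm := ⟨fun _ _ h => ⟨h.1.symm, by
    obtain ⟨u, v, hu, hv, huv⟩ := h.2
    exact ⟨v, u, hv, hu, huv.symm⟩⟩⟩
  loopless := ⟨fun _ h => h.1 rfl⟩

/-- `O` is obtained from the connected partition `r` and the acyclic orientation `Q` of the
partition graph: edges inside a block stay undirected, and edges between two different blocks
are directed as `Q` directs the pair of blocks. -/
def ObtainedFrom {V : Type*} {G : SimpleGraph V} (O : GOrientation G) (r : Setoid V)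
    (Q : GOrientation (partitionGraph G r)) : Prop :=
  IsConnectedPartition G r ∧ Q.IsAcyclic ∧
    ∀ u v, O.arc u v ↔ G.Adj u v ∧ Q.arc (Quotient.mk r u) (Quotient.mk r v)

/-- Partial acyclic orientations of `G`. -/
def PAO {V : Type*} (G : SimpleGraph V) : Type _ :=
  {O : GOrientation G // ∃ (r : Setoid V) (Q : GOrientation (partitionGraph G r)),
    ObtainedFrom O r Q}

/-- The connected partition associated to a partial acyclic orientation. -/
def PAO.partition {V : Type*} {G : SimpleGraph V} (O : PAO G) : Setoid V :=
  O.2.choose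

/-- The associated acyclic orientation of the partition graph. -/
def PAO.blockOrientation {V : Type*} {G : SimpleGraph V} (O : PAO G) :
    GOrientation (partitionGraph G O.partition) :=
  O.2.choose_spec.choose

theorem PAO.obtainedFrom {V : Type*} {G : SimpleGraph V} (O : PAO G) :
    ObtainedFrom O.1 O.partition O.blockOrientation :=
  O.2.choose_spec.choose_spec

/-- The blocks are determined by the orientation: they are the connected components of the graph
of undirected edges. -/
theorem ObtainedFrom.rel_iff {V : Type*} {G : SimpleGraph V} {O : GOrientation G} {r : Setoid V}
    {Q : GOrientation (partitionGraph G r)} (h : ObtainedFrom O r Q) (u v : V) :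
    r u v ↔ Relation.ReflTransGen (fun a b => G.Adj a b ∧ ¬ O.arc a b ∧ ¬ O.arc b a) u v := by
  obtain ⟨hc, hQ, hO⟩ := h
  constructor
  · intro huv
    have hpath := (hc (Quotient.mk r v)).preconnected ⟨u, Quotient.sound huv⟩ ⟨v, rfl⟩
    rw [SimpleGraph.reachable_iff_reflTransGen] at hpath
    refine Relation.ReflTransGen.lift (β := V)
      (Subtype.val : ({w | Quotient.mk r w = Quotient.mk r v} : Set V) → V) ?_ _ _ hpath
    rintro ⟨a, ha⟩ ⟨b, hb⟩ hab
    have hab' : G.Adj a b := by simpa using hab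
    have ha' : Quotient.mk r a = Quotient.mk r v := ha
    have hb' : Quotient.mk r b = Quotient.mk r v := hb
    refine ⟨hab', fun h => ?_, fun h => ?_⟩
    · have h2 := ((hO _ _).1 h).2
      rw [ha', hb'] at h2
      exact Q.asymm _ _ h2 h2
    · have h2 := ((hO _ _).1 h).2
      rw [ha', hb'] at h2
      exact Q.asymm _ _ h2 h2
  · intro h
    induction h with
    | refl => exact r.refl u
    | tail _ hbc ih =>
      refine r.trans ih ?_
      by_contra hne
      obtain ⟨hadj, h1, h2⟩ := hbc
      rcases hQ.1 _ _ ⟨fun h => hne (Quotient.exact h), _, _, rfl, rfl, hadj⟩ with h | h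
      · exact h1 ((hO _ _).2 ⟨hadj, h⟩)
      · exact h2 ((hO _ _).2 ⟨hadj.symm, h⟩)

/-- Hence the associated partition is well defined. -/
theorem ObtainedFrom.partition_eq {V : Type*} {G : SimpleGraph V} {O : PAO G} {r : Setoid V}
    {Q : GOrientation (partitionGraph G r)} (h : ObtainedFrom O.1 r Q) : O.partition = r :=
  Setoid.ext fun u v => (O.obtainedFrom.rel_iff u v).trans (h.rel_iff u v).symm

/-- The number of vertices minus the number of blocks. -/
def PAO.dim {V : Type*} {G : SimpleGraph V} (O : PAO G) : ℕ :=
  Nat.card V - Nat.card (Quotient O.partition)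

/-- The collection of order ideals of the acyclic orientation of the partition graph (a block `a`
is below a block `b` if there is a directed path from `a` to `b`), each one regarded as the set of
vertices that lie in its blocks. -/
def PAO.ideals {V : Type*} {G : SimpleGraph V} (O : PAO G) : Set (Set V) :=
  {S | ∃ I : Set (Quotient O.partition),
    (∀ a b, Relation.ReflTransGen O.blockOrientation.arc a b → b ∈ I → a ∈ I) ∧
      S = Quotient.mk O.partition ⁻¹' I}

/-! ### The abstract complex -/

/-- Abstract cell complexes: a partially ordered set of cells with a dimension function that is
strictly increasing. -/
def IsAbstractCellComplex {α : Type*} (le : α → α → Prop) (dim : α → ℕ) : Prop :=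
  (∀ a, le a a) ∧ (∀ a b, le a b → le b a → a = b) ∧ (∀ a b c, le a b → le b c → le a c) ∧
    ∀ a b, le a b → a ≠ b → dim a < dim b

/-- The cells: pairs of a nonempty vertex set `σ` and a partial acyclic orientation of `G[σ]`,
together with the nonempty proper subsets of the vertex set. -/
inductive YCell {n : ℕ} (G : SimpleGraph (Fin n)) : Type
  | pair (σ : Finset (Fin n)) (hσ : σ.Nonempty) (O : PAO (G.induce (σ : Set (Fin n)))) : YCell G
  | subset (ρ : Finset (Fin n)) (hρ : ρ.Nonempty) (hρ' : ρ ≠ Finset.univ) : YCell G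

/-- The ideals of a partial acyclic orientation of `G[σ]`, as subsets of the whole vertex set. -/
def idealsIn {n : ℕ} {G : SimpleGraph (Fin n)} {σ : Finset (Fin n)}
    (O : PAO (G.induce (σ : Set (Fin n)))) : Set (Set (Fin n)) :=
  (fun S => Subtype.val '' S) '' O.ideals

/-- The order relation between different cells. -/
def YCell.rel {n : ℕ} {G : SimpleGraph (Fin n)} : YCell G → YCell G → Prop
  | .subset ρ₀ _ _, .subset ρ₁ _ _ => ρ₀ ⊆ ρ₁
  | .subset ρ _ _, .pair σ _ _ => ρ ⊆ σᶜ
  | .pair _ _ O₀, .pair _ _ O₁ => idealsIn O₁ ⊆ idealsIn O₀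
  | .pair _ _ _, .subset _ _ _ => False

/-- The order relation of the abstract complex. -/
def YCell.le {n : ℕ} {G : SimpleGraph (Fin n)} (A B : YCell G) : Prop :=
  A = B ∨ A.rel B

/-- The dimension function of the abstract complex. -/
def YCell.dim {n : ℕ} {G : SimpleGraph (Fin n)} : YCell G → ℕ
  | .subset ρ _ _ => ρ.card - 1
  | .pair σ _ O => σᶜ.card + O.dim

/-! ### Polytopes and polytopal complexes -/

/-- Polytopes: convex hulls of finite sets of points. -/
def IsPolytope {E : Type*} [AddCommGroup E] [Module ℝ E] (P : Set E) : Prop :=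
  ∃ s : Set E, s.Finite ∧ P = convexHull ℝ s

/-- The affine dimension of a nonempty set. -/
def affDim {E : Type*} [AddCommGroup E] [Module ℝ E] (P : Set E) : ℕ :=
  Module.finrank ℝ (vectorSpan ℝ P)

/-- `F` is a nonempty face of `P`: the nonempty set of maximizers on `P` of a linear
functional (the functional `0` gives `P` itself). -/
def IsFace {E : Type*} [AddCommGroup E] [Module ℝ E] [TopologicalSpace E] (P F : Set E) : Prop :=
  F.Nonempty ∧ IsExposed ℝ P F

/-- Polytopal complexes, given by their nonempty (closed) cells: finitely many nonempty polytopes,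
with all their nonempty faces, any two of which are disjoint or meet in a common face. -/
structure IsPolytopalComplex {E : Type*} [AddCommGroup E] [Module ℝ E] [TopologicalSpace E]
    (C : Set (Set E)) : Prop where
  finite : C.Finite
  nonempty : ∀ P ∈ C, P.Nonempty
  polytope : ∀ P ∈ C, IsPolytope P
  face_mem : ∀ P ∈ C, ∀ F, IsFace P F → F ∈ C
  inter : ∀ P ∈ C, ∀ Q ∈ C, (P ∩ Q).Nonempty → IsFace P (P ∩ Q) ∧ IsFace Q (P ∩ Q)

/-- The polytopal complex `C` is a realization of the abstract cell complex on `α` with order `le`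
and dimension function `dim`: the nonempty cells of `C` correspond bijectively to the elements of
`α`, containment of cells to `le`, and affine dimension to `dim`. -/
def IsRealization {E : Type*} [AddCommGroup E] [Module ℝ E] [TopologicalSpace E]
    (C : Set (Set E)) {α : Type*} (le : α → α → Prop) (dim : α → ℕ) : Prop :=
  IsPolytopalComplex C ∧ ∃ f : α ≃ C,
    (∀ a b, le a b ↔ (f a : Set E) ⊆ (f b : Set E)) ∧ ∀ a, affDim (f a : Set E) = dim a

/-! ### The geometric complex -/

/-- The clean graphical zonotope. -/
def cleanZonotope {n : ℕ} (G : SimpleGraph (Fin n)) : Set (Fin n → ℝ) :=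
  {x | ∑ i, x i = (n : ℝ) + (G.edgeSet.ncard : ℝ) ∧
    ∀ σ : Finset (Fin n),
      (σ.card : ℝ) + ((G.induce (σ : Set (Fin n))).edgeSet.ncard : ℝ) ≤ ∑ i ∈ σ, x i}

/-- The dilated standard simplex, the convex hull of `N e₁, …, N eₙ`. -/
def dilatedSimplex (n : ℕ) (N : ℝ) : Set (Fin n → ℝ) :=
  convexHull ℝ (Set.range fun i : Fin n => N • (Pi.single i 1 : Fin n → ℝ))

/-- The join of the clean graphical zonotope and the dilated simplex, that is, the union of all
segments from a point of the former to a point of the latter. -/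
def zonoJoin {n : ℕ} (G : SimpleGraph (Fin n)) (N : ℝ) : Set (Fin n → ℝ) :=
  convexJoin ℝ (cleanZonotope G) (dilatedSimplex n N)

/-- The (closed) cells of the complex: all nonempty faces of the join, except the join itself and
the dilated simplex. -/
def complexY {n : ℕ} (G : SimpleGraph (Fin n)) (N : ℝ) : Set (Set (Fin n → ℝ)) :=
  {F | IsFace (zonoJoin G N) F ∧ F ≠ zonoJoin G N ∧ F ≠ dilatedSimplex n N}

end GraphZono

end

/-!
The join `[Z, NΔ]` is treated as a polyhedron. The clean rank function
`f S = |S| + |E(G[S])|` is supermodular, and `f S + f T` falls short of `f (S ∪ T) + f (S ∩ T)` by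
exactly the number of edges between `S \ T` and `T \ S` (`cleanRank_add_cleanRank`). Let `height`
be the affine function that is `1` on the hyperplane of `Z` and `0` on that of `NΔ`, and let
`slack S x = ∑ i ∈ S, x i - f S * height x`. Then the join is the set of points where `height` and
all slacks are nonnegative (`zonoJoin_eq_polyhedron`): at height `α` such a point dominates a point
of the base polytope of `α f`, and the remainder is a point of a dilated simplex.

For a polyhedron, a nonempty face is cut out by the inequalities that are tight at one of its
points, and its directions are those annihilated by the tight functionals
(`IsFace.exists_eq_polyFace`, `mem_vectorSpan_polyFace_tightAt`). Faces of faces, intersections,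
finiteness and the strict growth of the dimension all follow, so that everything reduces to
finding the possible sets of tight inequalities.

If `height` vanishes on a face, the face is one of the simplex. Otherwise the sets `S` whose slack
vanishes at a generic point form a lattice, because of the exact defect of modularity of the slack.
The same identity shows that no edge joins `S \ T` to `T \ S` for members `S`, `T`, and that a set
`X` is a member if there is a `Y` such that `X ∪ Y` and `X ∩ Y` are members and no edge joins
`X \ Y` to `Y \ X`. Such lattices are precisely the collections of ideals of partial acyclic
orientations of induced subgraphs (`exists_pao_of_lattice`); here it is convenient that a partial
acyclic orientation is an orientation without mixed directed cycles, and that its ideals are the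
vertex sets closed under predecessors along forward and undirected edges. Conversely, a partial
acyclic orientation of `G[σ]` gives a point of `Z`, at which each edge adds `1` to its head or `1/2`
to both ends, and the midpoint with the barycenter of the opposite face of the simplex has exactly
the ideals as its tight sets (`exists_slack_eq_zero_iff`).

The dimension is the corank of the slacks of the ideals. On the ideals `f` agrees with the
coordinate sums of a point of `Z`, which turns the slacks into sums over blocks after an invertible
change of coordinates; hence the rank is the number of blocks (`affDim_cellFace`).
-/

open scoped BigOperators

noncomputable section

namespace GraphZono

/-! ### Faces of polyhedra -/

section Polyhedron

variable {E ι : Type*} [AddCommGroup E] [Module ℝ E] [TopologicalSpace E]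

/-- The polyhedron of all points `x` with `c i ≤ φ i x` for every index `i`. -/
def polyhedron (φ : ι → E →L[ℝ] ℝ) (c : ι → ℝ) : Set E := {x | ∀ i, c i ≤ φ i x}

/-- The subset of the polyhedron on which all inequalities indexed by `I` are equalities. -/
def polyFace (φ : ι → E →L[ℝ] ℝ) (c : ι → ℝ) (I : Set ι) : Set E :=
  {x | x ∈ polyhedron φ c ∧ ∀ i ∈ I, φ i x = c i}

/-- The indices of the inequalities that are equalities at the point `p`. -/
def tightAt (φ : ι → E →L[ℝ] ℝ) (c : ι → ℝ) (p : E) : Set ι := {i | φ i p = c i}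

variable {φ : ι → E →L[ℝ] ℝ} {c : ι → ℝ}

theorem convex_polyhedron : Convex ℝ (polyhedron φ c) := by
  intro x hx y hy a b ha hb hab i
  have h1 := mul_le_mul_of_nonneg_left (hx i) ha
  have h2 := mul_le_mul_of_nonneg_left (hy i) hb
  have : c i = a * c i + b * c i := by rw [← add_mul, hab, one_mul]
  simp only [map_add, map_smul, smul_eq_mul]
  linarith

theorem isClosed_polyhedron : IsClosed (polyhedron φ c) := by
  simp only [polyhedron, Set.ofPred_forall]
  exact isClosed_iInter fun i => isClosed_le continuous_const (φ i).continuous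

theorem mem_polyFace_tightAt {p : E} (hp : p ∈ polyhedron φ c) :
    p ∈ polyFace φ c (tightAt φ c p) := ⟨hp, fun _ hi => hi⟩

theorem polyFace_anti {I J : Set ι} (h : I ⊆ J) : polyFace φ c J ⊆ polyFace φ c I :=
  fun _ hx => ⟨hx.1, fun i hi => hx.2 i (h hi)⟩

/-- A nonempty set cut out by tight inequalities is exposed by minus the sum of the corresponding
functionals. -/
theorem isFace_polyFace [Finite ι] [IsTopologicalAddGroup E] [ContinuousSMul ℝ E] {I : Set ι}
    (h : (polyFace φ c I).Nonempty) : IsFace (polyhedron φ c) (polyFace φ c I) := by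
  classical
  have := Fintype.ofFinite ι
  refine ⟨h, fun _ => ⟨-∑ i with i ∈ I, φ i, ?_⟩⟩
  obtain ⟨p, hp, hpI⟩ := h
  ext x
  have key : ∀ y : E, (-∑ i with i ∈ I, φ i) y = -∑ i with i ∈ I, φ i y := fun y => by
    rw [neg_apply, sum_apply]
  simp only [key, neg_le_neg_iff]
  constructor
  · rintro ⟨hx, hxI⟩
    refine ⟨hx, fun y hy => Finset.sum_le_sum fun i hi => ?_⟩
    rw [hxI i (by simpa using hi)]
    exact hy i
  · rintro ⟨hx, hxI⟩
    refine ⟨hx, fun i hi => ?_⟩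
    have h1 : ∑ i with i ∈ I, φ i p = ∑ i with i ∈ I, c i :=
      Finset.sum_congr rfl fun i hi => hpI i (by simpa using hi)
    have h2 : ∑ i with i ∈ I, c i = ∑ i with i ∈ I, φ i x :=
      le_antisymm (Finset.sum_le_sum fun i _ => hx i) (h1 ▸ hxI p hp)
    exact (((Finset.sum_eq_sum_iff_of_le fun i _ => hx i).1 h2) i (by simpa using hi)).symm

/-- From a point of a polyhedron one may move a little in every direction along which the
inequalities that are tight at the point do not decrease. -/
theorem exists_pos_add_smul_mem_polyhedron [Finite ι] {p d : E} (hp : p ∈ polyhedron φ c)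
    (hd : ∀ i ∈ tightAt φ c p, 0 ≤ φ i d) : ∃ ε : ℝ, 0 < ε ∧ p + ε • d ∈ polyhedron φ c := by
  have h : ∀ i, ∀ᶠ ε in nhdsWithin (0 : ℝ) (Set.Ioi 0), c i ≤ φ i p + ε * φ i d := by
    intro i
    by_cases hi : φ i p = c i
    · filter_upwards [self_mem_nhdsWithin] with ε hε
      rw [hi]
      have := mul_nonneg (le_of_lt hε) (hd i hi)
      linarith
    · have hlt : c i < φ i p := lt_of_le_of_ne (hp i) (Ne.symm hi)
      have hc : Filter.Tendsto (fun ε : ℝ => φ i p + ε * φ i d) (nhdsWithin (0 : ℝ) (Set.Ioi 0))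
          (nhds (φ i p + 0 * φ i d)) :=
        (Continuous.tendsto (by fun_prop) 0).mono_left nhdsWithin_le_nhds
      rw [zero_mul, add_zero] at hc
      exact (hc.eventually (lt_mem_nhds hlt)).mono fun _ h => h.le
  obtain ⟨ε, h1, h2⟩ := ((Filter.eventually_all.2 h).and self_mem_nhdsWithin).exists
  refine ⟨ε, h2, fun i => ?_⟩
  simpa using h1 i

/-- A nonempty convex subset of a polyhedron has a point at which only those inequalities are
tight that are tight on the whole subset. -/
theorem exists_forall_tightAt_subset [Finite ι] {F : Set E} (hF : F ⊆ polyhedron φ c)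
    (hne : F.Nonempty) (hconv : Convex ℝ F) :
    ∃ p ∈ F, ∀ x ∈ F, tightAt φ c p ⊆ tightAt φ c x := by
  -- A point with the least number of tight inequalities: passing to the midpoint with another
  -- point of the subset keeps no more than the common tight ones.
  obtain ⟨p, hp, hmin⟩ := exists_minimalFor_of_wellFoundedLT (fun p => p ∈ F)
    (fun p => (tightAt φ c p).ncard) hne
  refine ⟨p, hp, fun x hx => ?_⟩
  set m : E := (1 / 2 : ℝ) • p + (1 / 2 : ℝ) • x
  have hm : m ∈ F := hconv hp hx (by norm_num) (by norm_num) (by norm_num)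
  have hsub : ∀ i ∈ tightAt φ c m, φ i p = c i ∧ φ i x = c i := by
    intro i hi
    have h0 : φ i m = 1 / 2 * φ i p + 1 / 2 * φ i x := by simp [m]
    have h1 : φ i m = c i := hi
    have h2 := hF hp i
    have h3 := hF hx i
    constructor <;> linarith
  have hle : (tightAt φ c m).ncard ≤ (tightAt φ c p).ncard :=
    Set.ncard_le_ncard (fun i hi => (hsub i hi).1) (Set.toFinite _)
  have heq : tightAt φ c m = tightAt φ c p :=
    Set.eq_of_subset_of_ncard_le (fun i hi => (hsub i hi).1) (hmin hm hle) (Set.toFinite _)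
  exact fun i hi => (hsub i (heq ▸ hi)).2

/-- A nonempty convex extreme subset of a polyhedron is cut out by the inequalities that are tight
at one of its points. -/
theorem exists_eq_polyFace_of_isExtreme [Finite ι] {F : Set E} (hne : F.Nonempty)
    (hconv : Convex ℝ F) (hext : IsExtreme ℝ (polyhedron φ c) F) :
    ∃ p ∈ F, F = polyFace φ c (tightAt φ c p) := by
  obtain ⟨p, hp, hpt⟩ := exists_forall_tightAt_subset hext.subset hne hconv
  refine ⟨p, hp, Set.Subset.antisymm (fun x hx => ⟨hext.subset hx, fun i hi => hpt x hx hi⟩) ?_⟩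
  rintro y ⟨hy, hyI⟩
  -- The segment from `y` to `p` can be prolonged beyond `p`.
  obtain ⟨ε, hε, hmem⟩ := exists_pos_add_smul_mem_polyhedron (d := p - y) (hext.subset hp)
    (fun i hi => by
      have h1 : φ i p = c i := hi
      rw [map_sub, h1, hyI i hi, sub_self])
  refine hext.left_mem_of_mem_openSegment hy hmem hp
    ⟨ε / (1 + ε), 1 / (1 + ε), by positivity, by positivity, by field_simp; ring, ?_⟩
  have h1 : (1 : ℝ) + ε ≠ 0 := by positivity
  have : (1 + ε) • ((ε / (1 + ε)) • y + (1 / (1 + ε)) • (p + ε • (p - y))) = (1 + ε) • p := by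
    rw [smul_add, smul_smul, smul_smul, mul_div_cancel₀ _ h1, mul_div_cancel₀ _ h1]
    module
  exact smul_right_injective E h1 this

theorem IsFace.isExtreme {P F : Set E} (h : IsFace P F) : IsExtreme ℝ P F := h.2.isExtreme

theorem IsFace.subset {P F : Set E} (h : IsFace P F) : F ⊆ P := h.isExtreme.subset

theorem IsFace.exists_eq_polyFace [Finite ι] {F : Set E} (h : IsFace (polyhedron φ c) F) :
    ∃ p ∈ F, F = polyFace φ c (tightAt φ c p) :=
  exists_eq_polyFace_of_isExtreme h.1 (h.2.convex convex_polyhedron) h.isExtreme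

/-- A face of a face of a polyhedron is a face. -/
theorem IsFace.trans [Finite ι] [IsTopologicalAddGroup E] [ContinuousSMul ℝ E] {F F' : Set E}
    (h : IsFace (polyhedron φ c) F) (h' : IsFace F F') : IsFace (polyhedron φ c) F' := by
  obtain ⟨p, hp, hF⟩ := exists_eq_polyFace_of_isExtreme h'.1
    (h'.2.convex (h.2.convex convex_polyhedron)) (h.isExtreme.trans h'.isExtreme)
  rw [hF]
  exact isFace_polyFace (hF ▸ h'.1)

theorem IsFace.inter {P F F' : Set E} [ContinuousAdd E] (h : IsFace P F) (h' : IsFace P F')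
    (hne : (F ∩ F').Nonempty) : IsFace F (F ∩ F') ∧ IsFace F' (F ∩ F') :=
  ⟨⟨hne, (h.2.inter h'.2).mono h.subset Set.inter_subset_left⟩,
    ⟨hne, (h.2.inter h'.2).mono h'.subset Set.inter_subset_right⟩⟩

theorem finite_setOf_isFace [Finite ι] : {F | IsFace (polyhedron φ c) F}.Finite := by
  refine (Set.finite_range (polyFace φ c)).subset ?_
  intro F hF
  obtain ⟨p, -, h⟩ := IsFace.exists_eq_polyFace hF
  exact ⟨_, h.symm⟩

/-- A bounded polyhedron is the convex hull of its extreme points, of which there are finitely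
many; the same holds for its faces. -/
theorem IsFace.isPolytope [Finite ι] [IsTopologicalAddGroup E] [ContinuousSMul ℝ E] [T2Space E]
    [LocallyConvexSpace ℝ E] (hc : IsCompact (polyhedron φ c)) {F : Set E}
    (h : IsFace (polyhedron φ c) F) : IsPolytope F := by
  have hFc : IsCompact F := hc.of_isClosed_subset (h.2.isClosed isClosed_polyhedron) h.subset
  have hfin : (F.extremePoints ℝ).Finite := by
    have : Set.InjOn (fun x : E => ({x} : Set E)) (F.extremePoints ℝ) :=
      fun x _ y _ hxy => Set.singleton_injective hxy
    refine Set.Finite.of_finite_image ((Set.finite_range (polyFace φ c)).subset ?_) this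
    rintro _ ⟨x, hx, rfl⟩
    obtain ⟨p, -, hp⟩ := exists_eq_polyFace_of_isExtreme (φ := φ) (c := c)
      (Set.singleton_nonempty x) (convex_singleton x)
      (h.isExtreme.trans (isExtreme_singleton.2 hx))
    exact ⟨_, hp.symm⟩
  refine ⟨_, hfin, ?_⟩
  conv_lhs => rw [← closure_convexHull_extremePoints hFc (h.2.convex convex_polyhedron)]
  exact (hfin.isCompact_convexHull ℝ).isClosed.closure_eq

theorem isFace_self {P : Set E} (h : P.Nonempty) : IsFace P P := ⟨h, IsExposed.refl P⟩

/-- The directions of the face cut out by the inequalities that are tight at `p` are those that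
all the corresponding functionals annihilate. -/
theorem mem_vectorSpan_polyFace_tightAt [Finite ι] {p d : E} (hp : p ∈ polyhedron φ c) :
    d ∈ vectorSpan ℝ (polyFace φ c (tightAt φ c p)) ↔ ∀ i ∈ tightAt φ c p, φ i d = 0 := by
  constructor
  · intro hd i hi
    have hle : vectorSpan ℝ (polyFace φ c (tightAt φ c p)) ≤ (φ i : E →ₗ[ℝ] ℝ).ker := by
      refine Submodule.span_le.2 ?_
      rintro _ ⟨x, hx, y, hy, rfl⟩
      simp [hx.2 i hi, hy.2 i hi]
    exact hle hd
  · intro hd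
    obtain ⟨ε, hε, hmem⟩ := exists_pos_add_smul_mem_polyhedron hp fun i hi => (hd i hi).ge
    have h1 : p + ε • d ∈ polyFace φ c (tightAt φ c p) :=
      ⟨hmem, fun i hi => by
        have : φ i p = c i := hi
        simp [hd i hi, this]⟩
    have h2 := vsub_mem_vectorSpan ℝ h1 (mem_polyFace_tightAt hp)
    rw [vsub_eq_sub, add_sub_cancel_left] at h2
    simpa [smul_smul, inv_mul_cancel₀ hε.ne'] using Submodule.smul_mem _ ε⁻¹ h2

theorem IsFace.eq_of_subset_of_affDim_le [Finite ι] [FiniteDimensional ℝ E] {F F' : Set E}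
    (h : IsFace (polyhedron φ c) F) (h' : F' ⊆ polyhedron φ c) (hsub : F ⊆ F')
    (hdim : affDim F' ≤ affDim F) : F = F' := by
  obtain ⟨p, hp, hF⟩ := h.exists_eq_polyFace
  refine Set.Subset.antisymm hsub fun y hy => ?_
  have heq : vectorSpan ℝ F = vectorSpan ℝ F' :=
    Submodule.eq_of_le_of_finrank_le (vectorSpan_mono ℝ hsub) hdim
  have hd : y - p ∈ vectorSpan ℝ F := heq ▸ vsub_mem_vectorSpan ℝ hy (hsub hp)
  rw [hF, mem_vectorSpan_polyFace_tightAt (h.subset hp)] at hd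
  rw [hF]
  refine ⟨h' hy, fun i hi => ?_⟩
  have h1 := hd i hi
  rw [map_sub, sub_eq_zero] at h1
  exact h1.trans hi

end Polyhedron

/-! ### Partial acyclic orientations as orientations without mixed directed cycles -/

section Orientations

variable {V : Type*} {H : SimpleGraph V}

/-- One step from `u` to an adjacent vertex `v` that does not go against the direction of the
edge: the edge is directed from `u` to `v`, or undirected. -/
def GOrientation.Step (O : GOrientation H) (u v : V) : Prop := H.Adj u v ∧ ¬ O.arc v u

/-- `v` can be reached from `u` along edges that are directed forwards or undirected. -/
def GOrientation.Reach (O : GOrientation H) (u v : V) : Prop := Relation.ReflTransGen O.Step u v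

/-- A set of vertices that contains with `v` every `u` from which there is a step to `v`. -/
def GOrientation.IsLower (O : GOrientation H) (W : Set V) : Prop :=
  ∀ u v, H.Adj u v → v ∈ W → ¬ O.arc v u → u ∈ W

theorem GOrientation.step_of_arc {O : GOrientation H} {u v : V} (h : O.arc u v) : O.Step u v :=
  ⟨O.adj_of_arc _ _ h, O.asymm _ _ h⟩

theorem GOrientation.IsLower.mem_of_reach {O : GOrientation H} {W : Set V} (hW : O.IsLower W)
    {u v : V} (h : O.Reach u v) (hv : v ∈ W) : u ∈ W := by
  induction h using Relation.ReflTransGen.head_induction_on with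
  | refl => exact hv
  | head h _ ih => exact hW _ _ h.1 ih h.2

theorem PAO.reach_block (O : PAO H) {u v : V} (h : O.1.Reach u v) :
    Relation.ReflTransGen O.blockOrientation.arc (Quotient.mk O.partition u)
      (Quotient.mk O.partition v) := by
  obtain ⟨-, hQ, hO⟩ := O.obtainedFrom
  induction h with
  | refl => exact .refl
  | @tail b c _ hbc ih =>
    by_cases hne : Quotient.mk O.partition b = Quotient.mk O.partition c
    · exact hne ▸ ih
    · rcases hQ.1 _ _ ⟨hne, _, _, rfl, rfl, hbc.1⟩ with h | h
      · exact ih.tail h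
      · exact absurd ((hO _ _).2 ⟨hbc.1.symm, h⟩) hbc.2

theorem PAO.not_reach_of_arc (O : PAO H) {u v : V} (h : O.1.arc u v) : ¬ O.1.Reach v u := by
  intro hr
  obtain ⟨-, hQ, hO⟩ := O.obtainedFrom
  exact hQ.2 _ (Relation.TransGen.head' ((hO _ _).1 h).2 (O.reach_block hr))

theorem PAO.partition_rel_iff (O : PAO H) {u v : V} :
    O.partition u v ↔ O.1.Reach u v ∧ O.1.Reach v u := by
  constructor
  · have key : ∀ {a b}, O.partition a b → O.1.Reach a b := fun h =>
      Relation.ReflTransGen.mono (fun _ _ h => ⟨h.1, h.2.2⟩) _ _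
        ((O.obtainedFrom.rel_iff _ _).1 h)
    exact fun h => ⟨key h, key (O.partition.symm h)⟩
  · rintro ⟨h1, h2⟩
    obtain ⟨-, hQ, -⟩ := O.obtainedFrom
    refine Quotient.exact ?_
    rcases Relation.reflTransGen_iff_eq_or_transGen.1 (O.reach_block h1) with h | h
    · exact h.symm
    · exact absurd (h.trans_left (O.reach_block h2)) (hQ.2 _)

/-- The order ideals of a partial acyclic orientation, regarded as sets of vertices, are the lower
sets. -/
theorem PAO.mem_ideals_iff (O : PAO H) {W : Set V} : W ∈ O.ideals ↔ O.1.IsLower W := by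
  obtain ⟨-, hQ, hO⟩ := O.obtainedFrom
  constructor
  · rintro ⟨I, hI, rfl⟩ u v huv hv hvu
    exact hI _ _ (O.reach_block (.single ⟨huv, hvu⟩)) hv
  · intro hW
    have hsat : ∀ {u v}, Quotient.mk O.partition u = Quotient.mk O.partition v → v ∈ W → u ∈ W :=
      fun h hv => hW.mem_of_reach (O.partition_rel_iff.1 (Quotient.exact h)).1 hv
    refine ⟨Quotient.mk O.partition '' W, ?_, ?_⟩
    · intro a b hab hb
      induction hab using Relation.ReflTransGen.head_induction_on with
      | refl => exact hb
      | head h _ ih =>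
        obtain ⟨w, hw, hwb⟩ := ih
        obtain ⟨-, u, v, rfl, rfl, huv⟩ := O.blockOrientation.adj_of_arc _ _ h
        have harc : O.1.arc u v := (hO _ _).2 ⟨huv, h⟩
        exact ⟨u, hW _ _ huv (hsat hwb.symm hw) (O.1.asymm _ _ harc), rfl⟩
    · ext u
      exact ⟨fun hu => ⟨u, hu, rfl⟩, fun ⟨w, hw, h⟩ => hsat h.symm hw⟩

/-- The partition of the vertices into classes of mutually reachable ones. -/
def GOrientation.reachSetoid (O : GOrientation H) : Setoid V where
  r u v := O.Reach u v ∧ O.Reach v u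
  iseqv := ⟨fun _ => ⟨.refl, .refl⟩, fun h => ⟨h.2, h.1⟩,
    fun h h' => ⟨h.1.trans h'.1, h'.2.trans h.2⟩⟩

/-- An orientation that has no cycle of forward and undirected edges with at least one forward
edge is a partial acyclic orientation. -/
theorem GOrientation.exists_obtainedFrom (O : GOrientation H)
    (hO : ∀ u v, O.arc u v → ¬ O.Reach v u) :
    ∃ (r : Setoid V) (Q : GOrientation (partitionGraph H r)), ObtainedFrom O r Q := by
  have hex : ∀ {u v}, Quotient.mk O.reachSetoid u = Quotient.mk O.reachSetoid v → O.Reach u v :=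
    fun h => (Quotient.exact h : O.Reach _ _ ∧ O.Reach _ _).1
  let Q : GOrientation (partitionGraph H O.reachSetoid) :=
    { arc := fun a b => ∃ u v, Quotient.mk O.reachSetoid u = a ∧ Quotient.mk O.reachSetoid v = b ∧
        O.arc u v
      adj_of_arc := by
        rintro _ _ ⟨u, v, rfl, rfl, h⟩
        exact ⟨fun he => hO _ _ h (hex he.symm), u, v, rfl, rfl, O.adj_of_arc _ _ h⟩
      asymm := by
        rintro _ _ ⟨u, v, rfl, rfl, h⟩ ⟨v', u', hv, hu, h'⟩
        exact hO _ _ h (((hex hv.symm).tail (step_of_arc h')).trans (hex hu)) }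
  refine ⟨O.reachSetoid, Q, ?_, ⟨?_, ?_⟩, ?_⟩
  · intro c
    induction c using Quotient.inductionOn with | _ u =>
    have hu : u ∈ {v | Quotient.mk O.reachSetoid v = Quotient.mk O.reachSetoid u} := rfl
    have key : ∀ w (hw : O.Reach u w) (hw' : O.Reach w u),
        (H.induce {v | Quotient.mk O.reachSetoid v = Quotient.mk O.reachSetoid u}).Reachable
          ⟨u, hu⟩ ⟨w, Quotient.sound ⟨hw', hw⟩⟩ := by
      intro w hw
      induction hw with
      | refl => exact fun _ => .refl _
      | tail _ hbc ih =>
        intro hcu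
        refine (ih (hcu.head hbc)).trans (SimpleGraph.Adj.reachable ?_)
        exact hbc.1
    refine (SimpleGraph.connected_iff_exists_forall_reachable _).2 ⟨⟨u, hu⟩, ?_⟩
    rintro ⟨w, hw⟩
    exact key w (hex hw.symm) (hex hw)
  · rintro _ _ ⟨hne, u, v, rfl, rfl, huv⟩
    by_cases h1 : O.arc u v
    · exact .inl ⟨u, v, rfl, rfl, h1⟩
    by_cases h2 : O.arc v u
    · exact .inr ⟨v, u, rfl, rfl, h2⟩
    have hr : O.reachSetoid u v := ⟨.single ⟨huv, h2⟩, .single ⟨huv.symm, h1⟩⟩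
    exact absurd (Quotient.sound hr) hne
  · have key : ∀ a b, Relation.ReflTransGen Q.arc a b → ∀ u v, Quotient.mk O.reachSetoid u = a →
        Quotient.mk O.reachSetoid v = b → O.Reach u v := by
      intro a b hab
      induction hab with
      | refl => exact fun u v hu hv => hex (hu.trans hv.symm)
      | tail _ hbc ih =>
        rintro u v hu rfl
        obtain ⟨w, w', hw, hw', h⟩ := hbc
        exact ((ih u w hu hw).tail (step_of_arc h)).trans (hex hw')
    intro a ha
    obtain ⟨b, ⟨u, v, hu, hv, h⟩, hba⟩ := Relation.TransGen.head'_iff.1 ha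
    exact hO _ _ h (key _ _ hba v u hv hu)
  · intro u v
    refine ⟨fun h => ⟨O.adj_of_arc _ _ h, u, v, rfl, rfl, h⟩, ?_⟩
    rintro ⟨huv, u', v', hu, hv, h⟩
    by_contra hn
    exact hO _ _ h ((hex hv).trans (((hex hu.symm).head ⟨huv.symm, hn⟩)))

/-- An arc can be recovered from the lower sets. -/
theorem PAO.arc_iff (O : PAO H) {u v : V} :
    O.1.arc u v ↔ H.Adj u v ∧ ∃ W, O.1.IsLower W ∧ u ∈ W ∧ v ∉ W := by
  constructor
  · intro h
    exact ⟨O.1.adj_of_arc _ _ h, {w | O.1.Reach w u},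
      fun a b hab hb hba => Relation.ReflTransGen.head ⟨hab, hba⟩ hb, .refl, O.not_reach_of_arc h⟩
  · rintro ⟨huv, W, hW, hu, hv⟩
    by_contra hn
    exact hv (hW _ _ huv.symm hu hn)

theorem PAO.eq_of_ideals_eq {O O' : PAO H} (h : O.ideals = O'.ideals) : O = O' := by
  refine Subtype.ext (GOrientation.ext ?_)
  funext u v
  rw [eq_iff_iff, O.arc_iff, O'.arc_iff]
  simp only [← PAO.mem_ideals_iff, h]

end Orientations

/-! ### The clean rank function of a graph -/

/-- The indicator of adjacency, as a real number. -/
def adjInd {V : Type*} (G : SimpleGraph V) (u v : V) : ℝ := by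
  classical exact if G.Adj u v then 1 else 0

theorem adjInd_comm {V : Type*} (G : SimpleGraph V) (u v : V) : adjInd G u v = adjInd G v u := by
  by_cases h : G.Adj u v
  · simp [adjInd, h, h.symm]
  · have h' : ¬ G.Adj v u := fun h' => h h'.symm
    simp [adjInd, h, h']

theorem adjInd_nonneg {V : Type*} (G : SimpleGraph V) (u v : V) : 0 ≤ adjInd G u v := by
  unfold adjInd; split_ifs <;> norm_num

theorem two_mul_ncard_edgeSet {V : Type*} [Fintype V] (G : SimpleGraph V) :
    2 * (G.edgeSet.ncard : ℝ) = ∑ u, ∑ v, adjInd G u v := by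
  classical
  have h := G.sum_degrees_eq_twice_card_edges
  rw [Set.ncard_eq_toFinset_card', ← SimpleGraph.edgeFinset]
  have h2 : ((∑ v, G.degree v : ℕ) : ℝ) = ((2 * G.edgeFinset.card : ℕ) : ℝ) := by rw [h]
  push_cast at h2
  rw [← h2]
  refine Finset.sum_congr rfl fun u _ => ?_
  simp only [adjInd, Finset.sum_boole]
  rw [← SimpleGraph.card_neighborFinset_eq_degree, SimpleGraph.neighborFinset_eq_filter]

variable {n : ℕ}

/-- The number of vertices plus the number of edges of the subgraph induced on `S`. -/
def cleanRank (G : SimpleGraph (Fin n)) (S : Finset (Fin n)) : ℝ :=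
  (S.card : ℝ) + ((G.induce (S : Set (Fin n))).edgeSet.ncard : ℝ)

theorem cleanRank_eq (G : SimpleGraph (Fin n)) (S : Finset (Fin n)) :
    cleanRank G S = (S.card : ℝ) + (∑ u ∈ S, ∑ v ∈ S, adjInd G u v) / 2 := by
  have h := two_mul_ncard_edgeSet (G.induce (S : Set (Fin n)))
  have h2 : ∑ u : (S : Set (Fin n)), ∑ v : (S : Set (Fin n)),
      adjInd (G.induce (S : Set (Fin n))) u v = ∑ u ∈ S, ∑ v ∈ S, adjInd G u v := by
    rw [← Finset.sum_coe_sort S]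
    refine Finset.sum_congr rfl fun u _ => ?_
    rw [← Finset.sum_coe_sort S]
    rfl
  rw [h2] at h
  rw [cleanRank, ← h]
  ring

theorem cleanRank_empty (G : SimpleGraph (Fin n)) : cleanRank G ∅ = 0 := by simp [cleanRank_eq]

theorem cleanRank_univ (G : SimpleGraph (Fin n)) :
    cleanRank G Finset.univ = (n : ℝ) + (G.edgeSet.ncard : ℝ) := by
  rw [cleanRank_eq, ← two_mul_ncard_edgeSet, Finset.card_univ, Fintype.card_fin]
  ring

theorem cleanRank_nonneg (G : SimpleGraph (Fin n)) (S : Finset (Fin n)) : 0 ≤ cleanRank G S := by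
  unfold cleanRank; positivity

theorem sum_eq_sum_indicator (S : Finset (Fin n)) (g : Fin n → ℝ) :
    ∑ i ∈ S, g i = ∑ i, (if i ∈ S then 1 else 0) * g i := by
  simp [Finset.sum_ite_mem]

theorem sum_sum_eq_sum_indicator (S T : Finset (Fin n)) (g : Fin n → Fin n → ℝ) :
    ∑ i ∈ S, ∑ j ∈ T, g i j =
      ∑ i, ∑ j, (if i ∈ S then 1 else 0) * (if j ∈ T then 1 else 0) * g i j := by
  rw [sum_eq_sum_indicator]
  refine Finset.sum_congr rfl fun i _ => ?_
  rw [sum_eq_sum_indicator, Finset.mul_sum]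
  exact Finset.sum_congr rfl fun j _ => by ring

/-- The number of edges between two disjoint vertex sets; it measures how far the clean rank
function is from being modular. -/
def crossEdges (G : SimpleGraph (Fin n)) (S T : Finset (Fin n)) : ℝ :=
  ∑ u ∈ S, ∑ v ∈ T, adjInd G u v

theorem crossEdges_nonneg (G : SimpleGraph (Fin n)) (S T : Finset (Fin n)) :
    0 ≤ crossEdges G S T :=
  Finset.sum_nonneg fun _ _ => Finset.sum_nonneg fun _ _ => adjInd_nonneg G _ _

theorem crossEdges_eq_zero_iff (G : SimpleGraph (Fin n)) (S T : Finset (Fin n)) :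
    crossEdges G S T = 0 ↔ ∀ u ∈ S, ∀ v ∈ T, ¬ G.Adj u v := by
  unfold crossEdges
  rw [Finset.sum_eq_zero_iff_of_nonneg
    fun _ _ => Finset.sum_nonneg fun _ _ => adjInd_nonneg G _ _]
  refine forall₂_congr fun u _ => ?_
  rw [Finset.sum_eq_zero_iff_of_nonneg fun _ _ => adjInd_nonneg G _ _]
  refine forall₂_congr fun v _ => ?_
  simp [adjInd]

theorem cleanRank_add_cleanRank (G : SimpleGraph (Fin n)) (S T : Finset (Fin n)) :
    cleanRank G S + cleanRank G T + crossEdges G (S \ T) (T \ S) =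
      cleanRank G (S ∪ T) + cleanRank G (S ∩ T) := by
  have hcard : (S.card : ℝ) + T.card = (S ∪ T).card + (S ∩ T).card := by
    exact_mod_cast (Finset.card_union_add_card_inter S T).symm
  have hcomm : crossEdges G (S \ T) (T \ S) = crossEdges G (T \ S) (S \ T) := by
    unfold crossEdges
    rw [Finset.sum_comm]
    simp only [adjInd_comm G]
  have hsum : ∑ u ∈ S, ∑ v ∈ S, adjInd G u v + ∑ u ∈ T, ∑ v ∈ T, adjInd G u v +
      (crossEdges G (S \ T) (T \ S) + crossEdges G (T \ S) (S \ T)) =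
      ∑ u ∈ S ∪ T, ∑ v ∈ S ∪ T, adjInd G u v + ∑ u ∈ S ∩ T, ∑ v ∈ S ∩ T, adjInd G u v := by
    unfold crossEdges
    rw [sum_sum_eq_sum_indicator S, sum_sum_eq_sum_indicator T, sum_sum_eq_sum_indicator (S \ T),
      sum_sum_eq_sum_indicator (T \ S), sum_sum_eq_sum_indicator (S ∪ T),
      sum_sum_eq_sum_indicator (S ∩ T)]
    simp only [← Finset.sum_add_distrib]
    refine Finset.sum_congr rfl fun u _ => Finset.sum_congr rfl fun v _ => ?_
    by_cases h1 : u ∈ S <;> by_cases h2 : u ∈ T <;> by_cases h3 : v ∈ S <;> by_cases h4 : v ∈ T <;>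
      simp [h1, h2, h3, h4]
  rw [cleanRank_eq, cleanRank_eq, cleanRank_eq, cleanRank_eq]
  linarith

/-! ### Points of the zonotope given by orientations -/

/-- The share of the edge `{u, v}` that an orientation gives to `u`: all of it if the edge is
directed to `u`, none if it is directed to `v`, and one half if it is undirected. -/
def GOrientation.share {V : Type*} {G : SimpleGraph V} (O : GOrientation G) (u v : V) : ℝ := by
  classical exact if G.Adj u v then if O.arc u v then 0 else if O.arc v u then 1 else 1 / 2 else 0

theorem GOrientation.share_nonneg {V : Type*} {G : SimpleGraph V} (O : GOrientation G) (u v : V) :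
    0 ≤ O.share u v := by
  unfold share; split_ifs <;> norm_num

theorem GOrientation.share_eq_zero_iff {V : Type*} {G : SimpleGraph V} (O : GOrientation G)
    (u v : V) : O.share u v = 0 ↔ (G.Adj u v → O.arc u v) := by
  unfold share; split_ifs <;> simp_all

theorem GOrientation.share_add_share {V : Type*} {G : SimpleGraph V} (O : GOrientation G)
    (u v : V) : O.share u v + O.share v u = adjInd G u v := by
  unfold share adjInd
  rw [G.adj_comm v u]
  have := O.asymm u v
  split_ifs <;> simp_all
  norm_num

/-- The point of the zonotope to which each vertex contributes `1` and each edge distributes `1`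
among its endpoints according to the orientation. -/
def GOrientation.point {G : SimpleGraph (Fin n)} (O : GOrientation G) (u : Fin n) : ℝ :=
  1 + ∑ v, O.share u v

theorem GOrientation.sum_point {G : SimpleGraph (Fin n)} (O : GOrientation G)
    (S : Finset (Fin n)) :
    ∑ u ∈ S, O.point u = cleanRank G S + ∑ u ∈ S, ∑ v ∈ Sᶜ, O.share u v := by
  have h1 : ∑ u ∈ S, ∑ v ∈ S, adjInd G u v = 2 * ∑ u ∈ S, ∑ v ∈ S, O.share u v := by
    simp only [← O.share_add_share, Finset.sum_add_distrib]
    rw [two_mul]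
    congr 1
    exact Finset.sum_comm
  simp only [point, Finset.sum_add_distrib, ← Finset.sum_add_sum_compl S]
  rw [cleanRank_eq, h1]
  simp
  ring

/-- The sum over `S` of the coordinates of the point of an orientation is the least possible
exactly when all edges between `S` and its complement are directed out of `S`. -/
theorem GOrientation.sum_point_eq_iff {G : SimpleGraph (Fin n)} (O : GOrientation G)
    (S : Finset (Fin n)) :
    ∑ u ∈ S, O.point u = cleanRank G S ↔ O.IsLower (S : Set (Fin n)) := by
  rw [O.sum_point, add_eq_left, Finset.sum_eq_zero_iff_of_nonneg
    fun _ _ => Finset.sum_nonneg fun _ _ => O.share_nonneg _ _]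
  constructor
  · intro h u v huv hv hvu
    by_contra hu
    have := (Finset.sum_eq_zero_iff_of_nonneg fun _ _ => O.share_nonneg _ _).1 (h v hv) u
      (by simpa using hu)
    exact hvu ((O.share_eq_zero_iff _ _).1 this huv.symm)
  · intro h v hv
    refine Finset.sum_eq_zero fun u hu => (O.share_eq_zero_iff _ _).2 fun huv => ?_
    by_contra hvu
    exact (Finset.mem_compl.1 hu) (h u v huv.symm hv hvu)

theorem GOrientation.point_mem_cleanZonotope {G : SimpleGraph (Fin n)} (O : GOrientation G) :
    O.point ∈ cleanZonotope G := by
  refine ⟨?_, fun S => ?_⟩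
  · rw [O.sum_point, cleanRank_univ]
    simp
  · rw [O.sum_point]
    exact le_add_of_nonneg_right (Finset.sum_nonneg fun _ _ =>
      Finset.sum_nonneg fun _ _ => O.share_nonneg _ _)

/-- The orientation in which no edge is directed. -/
def undirected {V : Type*} (G : SimpleGraph V) : GOrientation G where
  arc _ _ := False
  adj_of_arc _ _ h := h.elim
  asymm _ _ h := h.elim

theorem cleanZonotope_nonempty (G : SimpleGraph (Fin n)) : (cleanZonotope G).Nonempty :=
  ⟨_, (undirected G).point_mem_cleanZonotope⟩

/-! ### The simplex and its faces -/

/-- The convex hull of the points `N eᵢ` with `i ∈ ρ`. -/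
def subSimplex (N : ℝ) (ρ : Finset (Fin n)) : Set (Fin n → ℝ) :=
  convexHull ℝ ((fun i : Fin n => N • (Pi.single i 1 : Fin n → ℝ)) '' ρ)

theorem subSimplex_univ (N : ℝ) : subSimplex N Finset.univ = dilatedSimplex n N := by
  simp [subSimplex, dilatedSimplex]

theorem mem_subSimplex_iff {N : ℝ} (hN : 0 < N) {ρ : Finset (Fin n)} {t : Fin n → ℝ} :
    t ∈ subSimplex N ρ ↔ (∀ i, 0 ≤ t i) ∧ ∑ i, t i = N ∧ ∀ i ∉ ρ, t i = 0 := by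
  constructor
  · have hconv : Convex ℝ {t : Fin n → ℝ | (∀ i, 0 ≤ t i) ∧ ∑ i, t i = N ∧ ∀ i ∉ ρ, t i = 0} := by
      rintro x ⟨hx0, hx1, hx2⟩ y ⟨hy0, hy1, hy2⟩ a b ha hb hab
      refine ⟨fun i => ?_, ?_, fun i hi => ?_⟩
      · have := mul_nonneg ha (hx0 i)
        have := mul_nonneg hb (hy0 i)
        simp only [Pi.add_apply, Pi.smul_apply, smul_eq_mul]
        linarith
      · simp only [Pi.add_apply, Pi.smul_apply, smul_eq_mul, Finset.sum_add_distrib,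
          ← Finset.mul_sum, hx1, hy1]
        rw [← add_mul, hab, one_mul]
      · simp [hx2 i hi, hy2 i hi]
    intro ht
    refine convexHull_min ?_ hconv ht
    rintro _ ⟨i, hi, rfl⟩
    refine ⟨fun j => ?_, ?_, fun j hj => ?_⟩
    · by_cases h : j = i
      · subst h; simpa using hN.le
      · simp [h]
    · simp [← Finset.mul_sum]
    · have : j ≠ i := fun h => hj (h ▸ hi)
      simp [this]
  · rintro ⟨h0, h1, h2⟩
    have hsum : ∑ i ∈ ρ, t i / N = 1 := by
      rw [← Finset.sum_div, Finset.sum_subset (Finset.subset_univ ρ) fun i _ hi => h2 i hi, h1,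
        div_self hN.ne']
    have h3 := (convex_convexHull ℝ _).sum_mem (fun i _ => div_nonneg (h0 i) hN.le) hsum
      fun i (hi : i ∈ ρ) => subset_convexHull ℝ
        ((fun i : Fin n => N • (Pi.single i 1 : Fin n → ℝ)) '' ρ) ⟨i, hi, rfl⟩
    have h4 : t = ∑ i ∈ ρ, (t i / N) • (N • (Pi.single i 1 : Fin n → ℝ)) := by
      funext j
      by_cases hj : j ∈ ρ
      · simp [Finset.sum_apply, Pi.single_apply, hj, hN.ne']
      · simp [Finset.sum_apply, Pi.single_apply, hj, h2 j hj]
    rw [h4]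
    exact h3

theorem single_mem_subSimplex_iff {N : ℝ} (hN : 0 < N) {ρ : Finset (Fin n)} {i : Fin n} :
    N • (Pi.single i 1 : Fin n → ℝ) ∈ subSimplex N ρ ↔ i ∈ ρ := by
  constructor
  · intro h
    by_contra hi
    have := ((mem_subSimplex_iff hN).1 h).2.2 i hi
    simp [hN.ne'] at this
  · exact fun hi => subset_convexHull ℝ _ ⟨i, hi, rfl⟩

theorem subSimplex_subset_iff {N : ℝ} (hN : 0 < N) {ρ ρ' : Finset (Fin n)} :
    subSimplex N ρ ⊆ subSimplex N ρ' ↔ ρ ⊆ ρ' :=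
  ⟨fun h _ hi => (single_mem_subSimplex_iff hN).1 (h ((single_mem_subSimplex_iff hN).2 hi)),
    fun h => convexHull_mono (Set.image_mono (by exact_mod_cast h))⟩

theorem subSimplex_nonempty {N : ℝ} {ρ : Finset (Fin n)} (h : ρ.Nonempty) :
    (subSimplex N ρ).Nonempty := by
  obtain ⟨i, hi⟩ := h
  exact ⟨_, subset_convexHull ℝ _ ⟨i, hi, rfl⟩⟩

theorem affDim_subSimplex {N : ℝ} (hN : 0 < N) {ρ : Finset (Fin n)} (h : ρ.Nonempty) :
    affDim (subSimplex N ρ) = ρ.card - 1 := by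
  have h1 : vectorSpan ℝ (subSimplex N ρ) =
      vectorSpan ℝ (Set.range fun i : ρ => N • (Pi.single (i : Fin n) 1 : Fin n → ℝ)) := by
    rw [← direction_affineSpan, subSimplex, affineSpan_convexHull, direction_affineSpan]
    congr 1
    ext x
    simp
  have hind : LinearIndependent ℝ
      fun i : ρ => N • (Pi.single (i : Fin n) 1 : Fin n → ℝ) := by
    have h2 : LinearIndependent ℝ fun i : Fin n => (Pi.single i 1 : Fin n → ℝ) :=
      Pi.linearIndependent_single_one (Fin n) ℝ
    exact (h2.comp _ Subtype.val_injective).units_smul fun _ => Units.mk0 N hN.ne'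
  rw [affDim, h1]
  refine (hind.affineIndependent ℝ).finrank_vectorSpan ?_
  have := h.card_pos
  simp only [Fintype.card_coe]
  omega

/-! ### Inequalities for the join -/

/-- Each point in the contrapolymatroid of a supermodular set function dominates a point of its
base polytope. -/
theorem exists_le_base_of_supermodular (f : Finset (Fin n) → ℝ) (hf : f ∅ = 0)
    (hsup : ∀ S T, f S + f T ≤ f (S ∪ T) + f (S ∩ T)) (x : Fin n → ℝ)
    (hx : ∀ S, f S ≤ ∑ i ∈ S, x i) :
    ∃ z : Fin n → ℝ, (∀ i, z i ≤ x i) ∧ (∀ S, f S ≤ ∑ i ∈ S, z i) ∧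
      ∑ i, z i = f Finset.univ := by
  classical
  let φ : Finset (Fin n) ⊕ Fin n → (Fin n → ℝ) →L[ℝ] ℝ :=
    Sum.elim (fun S => ∑ i ∈ S, ContinuousLinearMap.proj i) (fun i => -ContinuousLinearMap.proj i)
  let c : Finset (Fin n) ⊕ Fin n → ℝ := Sum.elim f (fun i => -x i)
  have hφ : ∀ S y, φ (.inl S) y = ∑ i ∈ S, y i := fun S y => by
    simp only [φ, Sum.elim_inl, sum_apply]; rfl
  have hK : ∀ z, z ∈ polyhedron φ c ↔ (∀ i, z i ≤ x i) ∧ ∀ S, f S ≤ ∑ i ∈ S, z i := by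
    intro z
    simp only [polyhedron, Set.mem_ofPred_eq, Sum.forall, hφ]
    simp [φ, c, and_comm]
  have hcomp : IsCompact (polyhedron φ c) := by
    refine (isCompact_Icc (a := fun i => f {i}) (b := x)).of_isClosed_subset
      isClosed_polyhedron fun z hz => ?_
    rw [hK] at hz
    exact ⟨fun i => by simpa using hz.2 {i}, hz.1⟩
  -- A minimizer of the sum of the coordinates lies in the base polytope: every coordinate is in a
  -- tight set, and tight sets are closed under unions.
  obtain ⟨z, hz, hmin⟩ := hcomp.exists_isMinOn ⟨x, (hK x).2 ⟨fun _ => le_rfl, hx⟩⟩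
    (f := fun z => ∑ i, z i) (by fun_prop)
  have hz' := (hK z).1 hz
  refine ⟨z, hz'.1, hz'.2, ?_⟩
  have htight : ∀ i, ∃ S, i ∈ S ∧ ∑ j ∈ S, z j = f S := by
    intro i
    by_contra! hno
    obtain ⟨ε, hε, hmem⟩ := exists_pos_add_smul_mem_polyhedron (d := -Pi.single i (1 : ℝ)) hz (by
      rintro (S | j) hS
      · have hS' : ∑ j ∈ S, z j = f S := (hφ S z).symm.trans hS
        have hi : i ∉ S := fun hi => hno S hi hS'
        rw [hφ]
        refine Finset.sum_nonneg fun j hj => ?_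
        have : j ≠ i := fun h => hi (h ▸ hj)
        simp [this]
      · by_cases h : j = i
        · subst h; simp [φ]
        · simp [φ, h])
    have := hmin hmem
    simp [Finset.sum_add_distrib, ← Finset.mul_sum] at this
    linarith
  choose S hiS hS using htight
  have hunion : ∀ A : Finset (Fin n), ∑ j ∈ A.biUnion S, z j = f (A.biUnion S) := by
    intro A
    induction A using Finset.induction_on with
    | empty => simp [hf]
    | insert i A _ ih =>
      rw [Finset.biUnion_insert]
      have h1 := hsup (S i) (A.biUnion S)
      have h2 := hz'.2 (S i ∪ A.biUnion S)
      have h3 := hz'.2 (S i ∩ A.biUnion S)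
      have h4 := Finset.sum_union_inter (s₁ := S i) (s₂ := A.biUnion S) (f := z)
      rw [hS, ih] at h4
      linarith
  have huniv : Finset.univ.biUnion S = Finset.univ :=
    Finset.eq_univ_iff_forall.2 fun i => Finset.mem_biUnion.2 ⟨i, Finset.mem_univ _, hiS i⟩
  rw [← huniv]
  exact hunion _

/-- The affine function that is `1` on the hyperplane of the zonotope and `0` on that of the
simplex. -/
def height (G : SimpleGraph (Fin n)) (N : ℝ) (x : Fin n → ℝ) : ℝ :=
  (∑ i, x i - N) / (cleanRank G Finset.univ - N)

/-- The affine function that is `∑ i ∈ S, x i - cleanRank G S` on the hyperplane of the zonotope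
and `∑ i ∈ S, x i` on that of the simplex. -/
def slack (G : SimpleGraph (Fin n)) (N : ℝ) (S : Finset (Fin n)) (x : Fin n → ℝ) : ℝ :=
  ∑ i ∈ S, x i - cleanRank G S * height G N x

/-- The linear parts of the functions `height` (for the index `none`) and `slack`. -/
def joinForm (G : SimpleGraph (Fin n)) (N : ℝ) :
    Option (Finset (Fin n)) → (Fin n → ℝ) →L[ℝ] ℝ
  | none => (cleanRank G Finset.univ - N)⁻¹ • ∑ i, ContinuousLinearMap.proj i
  | some S => ∑ i ∈ S, ContinuousLinearMap.proj i -
      (cleanRank G S / (cleanRank G Finset.univ - N)) • ∑ i, ContinuousLinearMap.proj i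

/-- Minus the constant parts of the functions `height` (for the index `none`) and `slack`. -/
def joinBound (G : SimpleGraph (Fin n)) (N : ℝ) : Option (Finset (Fin n)) → ℝ
  | none => N / (cleanRank G Finset.univ - N)
  | some S => -(cleanRank G S * (N / (cleanRank G Finset.univ - N)))

variable {G : SimpleGraph (Fin n)} {N : ℝ}

theorem joinForm_none (x : Fin n → ℝ) :
    joinForm G N none x = (∑ i, x i) / (cleanRank G Finset.univ - N) := by
  simp [joinForm, sum_apply, div_eq_inv_mul]

theorem joinForm_some (S : Finset (Fin n)) (x : Fin n → ℝ) :
    joinForm G N (some S) x =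
      ∑ i ∈ S, x i - cleanRank G S * ((∑ i, x i) / (cleanRank G Finset.univ - N)) := by
  simp [joinForm, sum_apply]
  ring

theorem joinForm_none_sub (x : Fin n → ℝ) :
    joinForm G N none x - joinBound G N none = height G N x := by
  rw [joinForm_none, joinBound, height, sub_div]

theorem joinForm_some_sub (S : Finset (Fin n)) (x : Fin n → ℝ) :
    joinForm G N (some S) x - joinBound G N (some S) = slack G N S x := by
  rw [joinForm_some, joinBound, slack, height]
  ring

theorem mem_joinPolyhedron_iff {x : Fin n → ℝ} :
    x ∈ polyhedron (joinForm G N) (joinBound G N) ↔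
      0 ≤ height G N x ∧ ∀ S, 0 ≤ slack G N S x := by
  simp only [← joinForm_none_sub, ← joinForm_some_sub, sub_nonneg]
  exact Option.forall

theorem joinForm_none_eq_iff {x : Fin n → ℝ} :
    joinForm G N none x = joinBound G N none ↔ height G N x = 0 := by
  rw [← joinForm_none_sub, sub_eq_zero]

theorem joinForm_some_eq_iff {S : Finset (Fin n)} {x : Fin n → ℝ} :
    joinForm G N (some S) x = joinBound G N (some S) ↔ slack G N S x = 0 := by
  rw [← joinForm_some_sub, sub_eq_zero]

theorem none_mem_tightAt {x : Fin n → ℝ} :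
    none ∈ tightAt (joinForm G N) (joinBound G N) x ↔ height G N x = 0 := joinForm_none_eq_iff

theorem some_mem_tightAt {S : Finset (Fin n)} {x : Fin n → ℝ} :
    some S ∈ tightAt (joinForm G N) (joinBound G N) x ↔ slack G N S x = 0 := joinForm_some_eq_iff

theorem height_combo {x y : Fin n → ℝ} {a b : ℝ} (hab : a + b = 1) :
    height G N (a • x + b • y) = a * height G N x + b * height G N y := by
  simp only [height, Pi.add_apply, Pi.smul_apply, smul_eq_mul, Finset.sum_add_distrib,
    ← Finset.mul_sum]
  have : N = a * N + b * N := by rw [← add_mul, hab, one_mul]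
  conv_lhs => rw [show ∀ A : ℝ, A - N = A - (a * N + b * N) from fun A => by rw [← this]]
  ring

theorem slack_combo {x y : Fin n → ℝ} {a b : ℝ} (hab : a + b = 1) (S : Finset (Fin n)) :
    slack G N S (a • x + b • y) = a * slack G N S x + b * slack G N S y := by
  simp only [slack, height_combo hab, Pi.add_apply, Pi.smul_apply, smul_eq_mul,
    Finset.sum_add_distrib, ← Finset.mul_sum]
  ring

theorem slack_empty (x : Fin n → ℝ) : slack G N ∅ x = 0 := by simp [slack, cleanRank_empty]

theorem slack_univ (hN' : N ≠ cleanRank G Finset.univ) (x : Fin n → ℝ) :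
    slack G N Finset.univ x = N * (1 - height G N x) := by
  have : cleanRank G Finset.univ - N ≠ 0 := sub_ne_zero.2 hN'.symm
  rw [slack, height]
  field_simp
  ring

/-- The exact defect of modularity of the slack, as a function of the vertex set. -/
theorem slack_add_slack (x : Fin n → ℝ) (S T : Finset (Fin n)) :
    slack G N S x + slack G N T x = slack G N (S ∪ T) x + slack G N (S ∩ T) x +
      height G N x * crossEdges G (S \ T) (T \ S) := by
  have h1 := cleanRank_add_cleanRank G S T
  have h2 := Finset.sum_union_inter (s₁ := S) (s₂ := T) (f := x)
  simp only [slack]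
  linear_combination -h2 - height G N x * h1

theorem mem_cleanZonotope_iff {x : Fin n → ℝ} :
    x ∈ cleanZonotope G ↔
      ∑ i, x i = cleanRank G Finset.univ ∧ ∀ S, cleanRank G S ≤ ∑ i ∈ S, x i := by
  rw [cleanRank_univ]
  rfl

theorem height_of_sum_eq (hN' : N ≠ cleanRank G Finset.univ) {x : Fin n → ℝ}
    (hx : ∑ i, x i = cleanRank G Finset.univ) : height G N x = 1 := by
  rw [height, hx, div_self (sub_ne_zero.2 hN'.symm)]

theorem slack_of_mem_cleanZonotope (hN' : N ≠ cleanRank G Finset.univ) {x : Fin n → ℝ}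
    (hx : x ∈ cleanZonotope G) (S : Finset (Fin n)) :
    slack G N S x = ∑ i ∈ S, x i - cleanRank G S := by
  rw [slack, height_of_sum_eq hN' (mem_cleanZonotope_iff.1 hx).1, mul_one]

theorem height_eq_zero_iff (hN' : N ≠ cleanRank G Finset.univ) {x : Fin n → ℝ} :
    height G N x = 0 ↔ ∑ i, x i = N := by
  rw [height, div_eq_zero_iff, or_iff_left (sub_ne_zero.2 hN'.symm), sub_eq_zero]

theorem slack_of_height_eq_zero {x : Fin n → ℝ} (hx : height G N x = 0) (S : Finset (Fin n)) :
    slack G N S x = ∑ i ∈ S, x i := by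
  rw [slack, hx, mul_zero, sub_zero]

theorem mem_dilatedSimplex_iff (hN : 0 < N) {t : Fin n → ℝ} :
    t ∈ dilatedSimplex n N ↔ (∀ i, 0 ≤ t i) ∧ ∑ i, t i = N := by
  simp [← subSimplex_univ, mem_subSimplex_iff hN]

theorem cleanZonotope_subset_joinPolyhedron (hN' : N ≠ cleanRank G Finset.univ) :
    cleanZonotope G ⊆ polyhedron (joinForm G N) (joinBound G N) := by
  intro x hx
  refine mem_joinPolyhedron_iff.2 ⟨?_, fun S => ?_⟩
  · rw [height_of_sum_eq hN' (mem_cleanZonotope_iff.1 hx).1]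
    exact zero_le_one
  · rw [slack_of_mem_cleanZonotope hN' hx]
    exact sub_nonneg.2 ((mem_cleanZonotope_iff.1 hx).2 S)

theorem dilatedSimplex_subset_joinPolyhedron (hN : 0 < N) (hN' : N ≠ cleanRank G Finset.univ) :
    dilatedSimplex n N ⊆ polyhedron (joinForm G N) (joinBound G N) := by
  intro x hx
  obtain ⟨h0, h1⟩ := (mem_dilatedSimplex_iff hN).1 hx
  have h2 := (height_eq_zero_iff hN').2 h1
  refine mem_joinPolyhedron_iff.2 ⟨h2.ge, fun S => ?_⟩
  rw [slack_of_height_eq_zero h2]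
  exact Finset.sum_nonneg fun i _ => h0 i

/-- The join is the polyhedron on which `height` and all `slack` functions are nonnegative. -/
theorem zonoJoin_eq_polyhedron (hn : 0 < n) (hN : 0 < N) (hN' : N ≠ cleanRank G Finset.univ) :
    zonoJoin G N = polyhedron (joinForm G N) (joinBound G N) := by
  refine Set.Subset.antisymm (fun x hx => ?_) fun x hx => ?_
  · obtain ⟨s, hs, t, ht, hst⟩ := mem_convexJoin.1 hx
    exact convex_polyhedron.segment_subset (cleanZonotope_subset_joinPolyhedron hN' hs)
      (dilatedSimplex_subset_joinPolyhedron hN hN' ht) hst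
  · obtain ⟨h0, hS⟩ := mem_joinPolyhedron_iff.1 hx
    have hD : cleanRank G Finset.univ - N ≠ 0 := sub_ne_zero.2 hN'.symm
    obtain ⟨α, hα⟩ : ∃ α, height G N x = α := ⟨_, rfl⟩
    have hsum : ∑ i, x i = α * cleanRank G Finset.univ + (1 - α) * N := by
      rw [← hα, height]
      field_simp
      ring
    have h1 : α ≤ 1 := by
      have := hS Finset.univ
      rw [slack_univ hN', hα] at this
      linarith [nonneg_of_mul_nonneg_right this hN]
    rw [hα] at h0
    have hxS : ∀ S, α * cleanRank G S ≤ ∑ i ∈ S, x i := fun S => by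
      have := hS S
      rw [slack, hα] at this
      linarith
    obtain ⟨t₀, ht₀⟩ : (dilatedSimplex n N).Nonempty := by
      rw [← subSimplex_univ]
      exact subSimplex_nonempty ⟨⟨0, hn⟩, Finset.mem_univ _⟩
    obtain ⟨z₀, hz₀⟩ := cleanZonotope_nonempty G
    rcases h0.eq_or_lt with rfl | hpos
    · refine mem_convexJoin.2 ⟨z₀, hz₀, x, (mem_dilatedSimplex_iff hN).2 ⟨fun i => ?_, ?_⟩,
        right_mem_segment ℝ _ _⟩
      · simpa using hxS {i}
      · simpa using hsum
    rcases h1.eq_or_lt with rfl | hlt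
    · refine mem_convexJoin.2 ⟨x, mem_cleanZonotope_iff.2 ⟨by simpa using hsum, ?_⟩, t₀, ht₀,
        left_mem_segment ℝ _ _⟩
      exact fun S => by simpa using hxS S
    obtain ⟨z, hzx, hzS, hz⟩ := exists_le_base_of_supermodular (fun S => α * cleanRank G S)
      (by simp [cleanRank_empty]) (fun S T => by
        have h1 := cleanRank_add_cleanRank G S T
        have h2 := crossEdges_nonneg G (S \ T) (T \ S)
        rw [← mul_add, ← mul_add]
        exact mul_le_mul_of_nonneg_left (by linarith) h0) x hxS
    have hβ : 0 < 1 - α := sub_pos.2 hlt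
    refine mem_convexJoin.2 ⟨α⁻¹ • z, mem_cleanZonotope_iff.2 ⟨?_, fun S => ?_⟩,
      (1 - α)⁻¹ • (x - z), (mem_dilatedSimplex_iff hN).2 ⟨fun i => ?_, ?_⟩,
      ⟨α, 1 - α, h0, hβ.le, by ring, ?_⟩⟩
    · simp only [Pi.smul_apply, smul_eq_mul, ← Finset.mul_sum, hz]
      field_simp
    · simp only [Pi.smul_apply, smul_eq_mul, ← Finset.mul_sum]
      rw [inv_mul_eq_div, le_div_iff₀' hpos]
      exact hzS S
    · exact mul_nonneg (inv_nonneg.2 hβ.le) (sub_nonneg.2 (hzx i))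
    · simp only [Pi.smul_apply, Pi.sub_apply, smul_eq_mul, ← Finset.mul_sum,
        Finset.sum_sub_distrib, hz, hsum]
      field_simp
      ring
    · rw [smul_smul, smul_smul, mul_inv_cancel₀ hpos.ne', mul_inv_cancel₀ hβ.ne', one_smul,
        one_smul, add_sub_cancel]

theorem isCompact_joinPolyhedron (hN : 0 < N) (hN' : N ≠ cleanRank G Finset.univ) :
    IsCompact (polyhedron (joinForm G N) (joinBound G N)) := by
  refine (isCompact_Icc (a := (0 : Fin n → ℝ))
    (b := fun _ => cleanRank G Finset.univ + N)).of_isClosed_subset isClosed_polyhedron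
    fun x hx => ?_
  obtain ⟨h0, hS⟩ := mem_joinPolyhedron_iff.1 hx
  have h1 : height G N x ≤ 1 := by
    have := hS Finset.univ
    rw [slack_univ hN'] at this
    linarith [nonneg_of_mul_nonneg_right this hN]
  have hx0 : ∀ i, 0 ≤ x i := fun i => by
    have h2 := hS {i}
    have h3 := mul_nonneg (cleanRank_nonneg G {i}) h0
    rw [slack, Finset.sum_singleton] at h2
    linarith
  refine ⟨hx0, fun i => ?_⟩
  have hD : cleanRank G Finset.univ - N ≠ 0 := sub_ne_zero.2 hN'.symm
  have hsum : ∑ i, x i =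
      height G N x * cleanRank G Finset.univ + (1 - height G N x) * N := by
    rw [height]
    field_simp
    ring
  have h4 := Finset.single_le_sum (fun i _ => hx0 i) (Finset.mem_univ i)
  have h5 := mul_le_of_le_one_left (cleanRank_nonneg G Finset.univ) h1
  have h6 := mul_le_of_le_one_left hN.le (show 1 - height G N x ≤ 1 by linarith)
  show x i ≤ cleanRank G Finset.univ + N
  linarith

/-! ### Lattices of vertex sets and partial acyclic orientations -/

theorem mem_idealsIn_iff {σ : Finset (Fin n)} (O : PAO (G.induce (σ : Set (Fin n))))
    {S : Set (Fin n)} :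
    S ∈ idealsIn O ↔ S ⊆ σ ∧ O.1.IsLower (Subtype.val ⁻¹' S) := by
  constructor
  · rintro ⟨W, hW, rfl⟩
    refine ⟨by rintro _ ⟨w, -, rfl⟩; exact w.2, ?_⟩
    rw [Set.preimage_image_eq _ Subtype.val_injective]
    exact O.mem_ideals_iff.1 hW
  · rintro ⟨hS, hlow⟩
    refine ⟨_, O.mem_ideals_iff.2 hlow, ?_⟩
    exact (Subtype.image_preimage_coe _ _).trans (Set.inter_eq_right.2 hS)

theorem coe_mem_idealsIn {σ : Finset (Fin n)} (O : PAO (G.induce (σ : Set (Fin n)))) :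
    (σ : Set (Fin n)) ∈ idealsIn O :=
  (mem_idealsIn_iff O).2 ⟨subset_rfl, fun u _ _ _ _ => u.2⟩

theorem idealsIn_subset_idealsIn_iff {σ τ : Finset (Fin n)}
    (O : PAO (G.induce (σ : Set (Fin n)))) (O' : PAO (G.induce (τ : Set (Fin n)))) :
    idealsIn O ⊆ idealsIn O' ↔
      ∀ S : Finset (Fin n), (S : Set (Fin n)) ∈ idealsIn O → (S : Set (Fin n)) ∈ idealsIn O' := by
  classical
  refine ⟨fun h S hS => h hS, fun h S hS => ?_⟩
  have := h S.toFinset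
  rw [Set.coe_toFinset] at this
  exact this hS

/-- A pair of a vertex set and a partial acyclic orientation of its induced subgraph can be
recovered from the ideals. -/
theorem eq_of_idealsIn_eq {σ τ : Finset (Fin n)} {hσ : σ.Nonempty} {hτ : τ.Nonempty}
    {O : PAO (G.induce (σ : Set (Fin n)))} {O' : PAO (G.induce (τ : Set (Fin n)))}
    (h : idealsIn O = idealsIn O') : YCell.pair σ hσ O = YCell.pair τ hτ O' := by
  have h1 : (σ : Set (Fin n)) ⊆ τ :=
    ((mem_idealsIn_iff O').1 (h ▸ coe_mem_idealsIn O)).1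
  have h2 : (τ : Set (Fin n)) ⊆ σ :=
    ((mem_idealsIn_iff O).1 (h ▸ coe_mem_idealsIn O')).1
  obtain rfl : σ = τ := Finset.coe_injective (h1.antisymm h2)
  have : O.ideals = O'.ideals :=
    (Set.image_injective.2 (Set.image_injective.2 Subtype.val_injective)) h
  rw [PAO.eq_of_ideals_eq this]

/-- A lattice of vertex sets consists of the ideals of a partial acyclic orientation as soon as no
edge joins the two differences of two of its members and, conversely, two sets without such an edge
belong to the lattice whenever their union and intersection do. -/
theorem exists_pao_of_lattice (J : Set (Finset (Fin n))) (hempty : ∅ ∈ J)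
    (hunion : ∀ S ∈ J, ∀ T ∈ J, S ∪ T ∈ J) (hinter : ∀ S ∈ J, ∀ T ∈ J, S ∩ T ∈ J)
    (hcross : ∀ S ∈ J, ∀ T ∈ J, ∀ u ∈ S \ T, ∀ v ∈ T \ S, ¬ G.Adj u v)
    (hsplit : ∀ X Y, X ∪ Y ∈ J → X ∩ Y ∈ J → (∀ u ∈ X \ Y, ∀ v ∈ Y \ X, ¬ G.Adj u v) → X ∈ J) :
    ∃ (σ : Finset (Fin n)) (O : PAO (G.induce (σ : Set (Fin n)))),
      ∀ S : Finset (Fin n), (S : Set (Fin n)) ∈ idealsIn O ↔ S ∈ J := by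
  classical
  have hbU : ∀ (A : Finset (Fin n)) (f : Fin n → Finset (Fin n)), (∀ a ∈ A, f a ∈ J) →
      A.biUnion f ∈ J := fun A f h => by
    rw [← Finset.sup_eq_biUnion]
    exact Finset.sup_induction hempty hunion h
  set σ : Finset (Fin n) := (Finset.univ.filter (· ∈ J)).sup id with hσdef
  have hσJ : σ ∈ J := Finset.sup_induction hempty hunion fun S hS => (Finset.mem_filter.1 hS).2
  have hσmax : ∀ S ∈ J, S ⊆ σ := fun S hS =>
    Finset.le_sup (f := id) (Finset.mem_filter.2 ⟨Finset.mem_univ _, hS⟩)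
  -- `D v` is the least member of the lattice that contains `v`.
  set D : Fin n → Finset (Fin n) := fun v => (Finset.univ.filter fun S => S ∈ J ∧ v ∈ S).inf id
    with hDdef
  have hD : ∀ u v, u ∈ D v ↔ ∀ S ∈ J, v ∈ S → u ∈ S := fun u v => by simp [hDdef, Finset.mem_inf]
  have hself : ∀ v, v ∈ D v := fun v => (hD v v).2 fun _ _ h => h
  have hDJ : ∀ v ∈ σ, D v ∈ J := fun v hv => by
    have hne : (Finset.univ.filter fun S => S ∈ J ∧ v ∈ S).Nonempty :=
      ⟨σ, by simp [hσJ, hv]⟩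
    rw [hDdef]
    dsimp only
    rw [← Finset.inf'_eq_inf hne]
    exact Finset.inf'_induction hne _ hinter fun S hS => (Finset.mem_filter.1 hS).2.1
  have hDmono : ∀ u v, u ∈ D v → D u ⊆ D v := fun u v h w hw =>
    (hD w v).2 fun S hS hv => (hD w u).1 hw S hS ((hD u v).1 h S hS hv)
  have hDsub : ∀ v S, S ∈ J → v ∈ S → D v ⊆ S := fun v S hS hv w hw => (hD w v).1 hw S hS hv
  let O₀ : GOrientation (G.induce (σ : Set (Fin n))) :=
    { arc := fun u v => G.Adj u v ∧ (v : Fin n) ∉ D u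
      adj_of_arc := fun _ _ h => h.1
      asymm := fun u v h h' => hcross _ (hDJ u u.2) _ (hDJ v v.2) u
        (Finset.mem_sdiff.2 ⟨hself _, h'.2⟩) v (Finset.mem_sdiff.2 ⟨hself _, h.2⟩) h.1 }
  have hreach : ∀ u v, O₀.Reach u v → (u : Fin n) ∈ D v := by
    intro u v h
    induction h with
    | refl => exact hself _
    | @tail b c _ hbc ih =>
      have : (b : Fin n) ∈ D c := by
        by_contra hn
        exact hbc.2 ⟨hbc.1.symm, hn⟩
      exact hDmono _ _ this ih
  let O : PAO (G.induce (σ : Set (Fin n))) :=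
    ⟨O₀, O₀.exists_obtainedFrom fun u v huv hvu => huv.2 (hreach _ _ hvu)⟩
  have hlow : ∀ S : Finset (Fin n), S ⊆ σ → (O₀.IsLower (Subtype.val ⁻¹' (S : Set (Fin n))) ↔
      ∀ u ∈ σ, ∀ v ∈ S, G.Adj u v → u ∈ D v → u ∈ S) := by
    intro S hS
    constructor
    · intro h u hu v hv huv huD
      exact h ⟨u, hu⟩ ⟨v, hS hv⟩ huv hv fun harc => harc.2 huD
    · intro h u v huv hv hvu
      refine h u u.2 v hv huv ?_
      by_contra hn
      exact hvu ⟨huv.symm, hn⟩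
  refine ⟨σ, O, fun S => (mem_idealsIn_iff O).trans ?_⟩
  constructor
  · rintro ⟨hSσ, hS⟩
    rw [Finset.coe_subset] at hSσ
    rw [show O.1 = O₀ from rfl, hlow S hSσ] at hS
    -- By induction on the size of `D v`, the set `S` contains `D v` for each of its elements `v`.
    have key : ∀ k, ∀ v ∈ S, (D v).card = k → D v ⊆ S := by
      intro k
      induction k using Nat.strong_induction_on with
      | _ k ih =>
        intro v hv hk
        set T := ((S ∩ D v).filter fun u => v ∉ D u).biUnion D with hTdef
        have hTJ : T ∈ J := hbU _ _ fun u hu =>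
          hDJ u (hSσ (Finset.mem_inter.1 (Finset.mem_filter.1 hu).1).1)
        have hTS : T ⊆ S := by
          refine Finset.biUnion_subset.2 fun u hu => ?_
          obtain ⟨hu1, hu2⟩ := Finset.mem_filter.1 hu
          obtain ⟨huS, huD⟩ := Finset.mem_inter.1 hu1
          refine ih _ ?_ u huS rfl
          rw [← hk]
          exact Finset.card_lt_card ((Finset.ssubset_iff_of_subset (hDmono _ _ huD)).2
            ⟨v, hself v, hu2⟩)
        have hTD : T ⊆ D v := by
          refine Finset.biUnion_subset.2 fun u hu => hDmono _ _ ?_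
          exact (Finset.mem_inter.1 (Finset.mem_filter.1 hu).1).2
        have hXJ : S ∩ D v ∈ J := by
          refine hsplit (S ∩ D v) (T ∪ (D v \ S)) ?_ ?_ ?_
          · convert hDJ v (hSσ hv) using 1
            ext w
            have := @hTD w
            simp only [Finset.mem_union, Finset.mem_inter, Finset.mem_sdiff]
            tauto
          · convert hTJ using 1
            ext w
            have := @hTD w
            have := @hTS w
            simp only [Finset.mem_union, Finset.mem_inter, Finset.mem_sdiff]
            tauto
          · intro a ha b hb hab
            simp only [Finset.mem_union, Finset.mem_inter, Finset.mem_sdiff, not_or, not_and,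
              not_not] at ha hb
            have hbD : b ∈ D v := hb.1.elim (fun h => hTD h) fun h => h.1
            have hbS : b ∉ S := fun h => hb.2 h hbD
            -- Outside `T`, the elements of `S ∩ D v` generate the same member as `v`.
            have hva : v ∈ D a := by
              by_contra hva
              refine ha.2.1 (Finset.mem_biUnion.2 ⟨a, ?_, hself a⟩)
              simp [ha.1.1, ha.1.2, hva]
            exact hbS (hS b (hDsub v σ hσJ (hSσ hv) hbD) a ha.1.1 hab.symm (hDmono _ _ hva hbD))
        exact (hDsub v _ hXJ (Finset.mem_inter.2 ⟨hv, hself v⟩)).trans Finset.inter_subset_left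
    have : S = S.biUnion D := by
      refine Finset.Subset.antisymm (fun v hv => Finset.mem_biUnion.2 ⟨v, hv, hself v⟩) ?_
      exact Finset.biUnion_subset.2 fun v hv => key _ v hv rfl
    rw [this]
    exact hbU _ _ fun v hv => hDJ v (hSσ hv)
  · intro hS
    refine ⟨Finset.coe_subset.2 (hσmax S hS), ?_⟩
    rw [show O.1 = O₀ from rfl, hlow S (hσmax S hS)]
    exact fun u _ v hv _ huD => hDsub v S hS hv huD

/-! ### The faces given by partial acyclic orientations -/

/-- The face of the join cut out by the slacks of all ideals of a partial acyclic orientation of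
an induced subgraph. The vertex set of the subgraph may be empty; the face is then the whole
join. -/
def cellFace (N : ℝ) {σ : Finset (Fin n)} (O : PAO (G.induce (σ : Set (Fin n)))) :
    Set (Fin n → ℝ) :=
  {x | x ∈ polyhedron (joinForm G N) (joinBound G N) ∧
    ∀ S : Finset (Fin n), (S : Set (Fin n)) ∈ idealsIn O → slack G N S x = 0}

/-- The extension of an orientation of an induced subgraph on `σ` to the whole graph: the edges
that leave `σ` are directed outwards, those outside `σ` are undirected. -/
def GOrientation.extend {σ : Finset (Fin n)} (O : GOrientation (G.induce (σ : Set (Fin n)))) :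
    GOrientation G where
  arc u v := G.Adj u v ∧ ((∃ hu hv, O.arc ⟨u, hu⟩ ⟨v, hv⟩) ∨ u ∈ σ ∧ v ∉ σ)
  adj_of_arc _ _ h := h.1
  asymm := by
    rintro u v ⟨-, ⟨hu, hv, h⟩ | h⟩ ⟨-, ⟨hv', hu', h'⟩ | h'⟩
    · exact O.asymm _ _ h h'
    · exact h'.2 hu
    · exact h.2 hv'
    · exact h.2 h'.1

theorem GOrientation.extend_isLower_iff {σ : Finset (Fin n)}
    (O : GOrientation (G.induce (σ : Set (Fin n)))) {S : Set (Fin n)} (hS : S ⊆ σ) :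
    O.extend.IsLower S ↔ O.IsLower (Subtype.val ⁻¹' S) := by
  constructor
  · intro h u v huv hv hvu
    refine h u v huv hv ?_
    rintro ⟨-, ⟨_, _, h'⟩ | h'⟩
    · exact hvu h'
    · exact h'.2 u.2
  · intro h u v huv hv hvu
    have hvσ := hS hv
    have huσ : u ∈ (σ : Set (Fin n)) := by
      by_contra hu
      exact hvu ⟨huv.symm, .inr ⟨hvσ, hu⟩⟩
    exact h ⟨u, huσ⟩ ⟨v, hvσ⟩ huv hv fun h' => hvu ⟨huv.symm, .inl ⟨hvσ, huσ, h'⟩⟩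

/-- The relative interior of the face of a partial acyclic orientation: at some point of the join
off the simplex, exactly the slacks of the ideals vanish. -/
theorem exists_slack_eq_zero_iff (hN : 0 < N) (hN' : N ≠ cleanRank G Finset.univ)
    {σ : Finset (Fin n)} (O : PAO (G.induce (σ : Set (Fin n)))) :
    ∃ p ∈ polyhedron (joinForm G N) (joinBound G N), 0 < height G N p ∧
      ∀ S : Finset (Fin n), slack G N S p = 0 ↔ (S : Set (Fin n)) ∈ idealsIn O := by
  set x := O.1.extend.point
  have hxZ : x ∈ cleanZonotope G := O.1.extend.point_mem_cleanZonotope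
  have hxP := cleanZonotope_subset_joinPolyhedron hN' hxZ
  have hx1 : height G N x = 1 := height_of_sum_eq hN' (mem_cleanZonotope_iff.1 hxZ).1
  have hx : ∀ S : Finset (Fin n), slack G N S x = 0 ↔ O.1.extend.IsLower (S : Set (Fin n)) := by
    intro S
    rw [slack_of_mem_cleanZonotope hN' hxZ, sub_eq_zero, O.1.extend.sum_point_eq_iff]
  by_cases hσ : σ = Finset.univ
  · subst hσ
    refine ⟨x, hxP, by rw [hx1]; exact one_pos, fun S => ?_⟩
    have hS : (S : Set (Fin n)) ⊆ (Finset.univ : Finset (Fin n)) := by simp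
    rw [hx, O.1.extend_isLower_iff hS, mem_idealsIn_iff, and_iff_right hS]
  · -- The midpoint of the point of the extended orientation and the barycenter of the face of the
    -- simplex opposite to `σ`.
    have hρ : (σᶜ).Nonempty := by rwa [Finset.nonempty_iff_ne_empty, Ne, Finset.compl_eq_empty_iff]
    have hcard : (0 : ℝ) < (σᶜ).card := by exact_mod_cast hρ.card_pos
    set t : Fin n → ℝ := fun i => if i ∈ σ then 0 else N / (σᶜ).card with ht
    have ht0 : ∀ i, 0 ≤ t i := fun i => by
      rw [ht]; dsimp only; split_ifs
      · exact le_rfl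
      · positivity
    have htsum : ∑ i, t i = N := by
      rw [← Finset.sum_add_sum_compl σ,
        Finset.sum_eq_zero (s := σ) (fun i hi => by simp [ht, hi]), zero_add,
        Finset.sum_congr rfl (g := fun _ => N / (σᶜ).card)
          (fun i hi => by simp [ht, Finset.mem_compl.1 hi]), Finset.sum_const, nsmul_eq_mul]
      field_simp
    have htΔ : t ∈ dilatedSimplex n N := (mem_dilatedSimplex_iff hN).2 ⟨ht0, htsum⟩
    have htP := dilatedSimplex_subset_joinPolyhedron hN hN' htΔ
    have hth := (height_eq_zero_iff hN').2 htsum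
    have hab : (1 / 2 : ℝ) + 1 / 2 = 1 := by norm_num
    refine ⟨(1 / 2 : ℝ) • x + (1 / 2 : ℝ) • t,
      convex_polyhedron hxP htP (by norm_num) (by norm_num) hab, ?_, fun S => ?_⟩
    · rw [height_combo hab, hx1, hth]
      norm_num
    · have h1 := (mem_joinPolyhedron_iff.1 hxP).2 S
      have h2 := (mem_joinPolyhedron_iff.1 htP).2 S
      have h3 : slack G N S t = 0 ↔ (S : Set (Fin n)) ⊆ σ := by
        rw [slack_of_height_eq_zero hth, Finset.sum_eq_zero_iff_of_nonneg fun i _ => ht0 i]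
        refine forall₂_congr fun i _ => ?_
        by_cases hi : i ∈ σ <;> simp [ht, hi, hN.ne', hρ.ne_empty]
      rw [slack_combo hab, mem_idealsIn_iff, ← h3]
      constructor
      · intro h
        have h4 : slack G N S t = 0 := by linarith
        refine ⟨h4, ?_⟩
        rw [← O.1.extend_isLower_iff (h3.1 h4), ← hx]
        linarith
      · rintro ⟨h4, h5⟩
        rw [← O.1.extend_isLower_iff (h3.1 h4), ← hx] at h5
        rw [h4, h5]
        norm_num

/-- The point of the zonotope used to linearize the clean rank function on the ideals. -/
theorem exists_mem_cleanZonotope_sum_eq {σ : Finset (Fin n)}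
    (O : PAO (G.induce (σ : Set (Fin n)))) :
    ∃ z ∈ cleanZonotope G, ∀ S : Finset (Fin n), (S : Set (Fin n)) ∈ idealsIn O →
      ∑ i ∈ S, z i = cleanRank G S := by
  refine ⟨_, O.1.extend.point_mem_cleanZonotope, fun S hS => ?_⟩
  rw [mem_idealsIn_iff] at hS
  rw [O.1.extend.sum_point_eq_iff, O.1.extend_isLower_iff hS.1]
  exact hS.2

theorem cellFace_eq_polyFace {σ : Finset (Fin n)} {O : PAO (G.induce (σ : Set (Fin n)))}
    {p : Fin n → ℝ} (hp : 0 < height G N p)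
    (hpS : ∀ S : Finset (Fin n), slack G N S p = 0 ↔ (S : Set (Fin n)) ∈ idealsIn O) :
    cellFace N O = polyFace (joinForm G N) (joinBound G N)
      (tightAt (joinForm G N) (joinBound G N) p) := by
  ext x
  refine and_congr_right fun _ => ?_
  rw [Option.forall, none_mem_tightAt]
  simp only [some_mem_tightAt, hpS, joinForm_some_eq_iff]
  exact (and_iff_right fun h => absurd h hp.ne').symm

theorem isFace_cellFace (hN : 0 < N) (hN' : N ≠ cleanRank G Finset.univ)
    {σ : Finset (Fin n)} (O : PAO (G.induce (σ : Set (Fin n)))) :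
    IsFace (polyhedron (joinForm G N) (joinBound G N)) (cellFace N O) := by
  obtain ⟨p, hp, hp0, hpS⟩ := exists_slack_eq_zero_iff hN hN' O
  rw [cellFace_eq_polyFace hp0 hpS]
  exact isFace_polyFace ⟨p, mem_polyFace_tightAt hp⟩

/-- The order among the faces of partial acyclic orientations is the reverse inclusion of
ideals. -/
theorem cellFace_subset_cellFace_iff (hN : 0 < N) (hN' : N ≠ cleanRank G Finset.univ)
    {σ τ : Finset (Fin n)} (O : PAO (G.induce (σ : Set (Fin n))))
    (O' : PAO (G.induce (τ : Set (Fin n)))) :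
    cellFace N O ⊆ cellFace N O' ↔ idealsIn O' ⊆ idealsIn O := by
  rw [idealsIn_subset_idealsIn_iff]
  constructor
  · intro h S hS
    obtain ⟨p, hp, -, hpS⟩ := exists_slack_eq_zero_iff hN hN' O
    exact (hpS S).1 ((h ⟨hp, fun S hS => (hpS S).2 hS⟩).2 S hS)
  · exact fun h x hx => ⟨hx.1, fun S hS => hx.2 S (h S hS)⟩

theorem exists_mem_cellFace_height_pos (hN : 0 < N) (hN' : N ≠ cleanRank G Finset.univ)
    {σ : Finset (Fin n)} (O : PAO (G.induce (σ : Set (Fin n)))) :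
    ∃ p ∈ cellFace N O, 0 < height G N p := by
  obtain ⟨p, hp, hp0, hpS⟩ := exists_slack_eq_zero_iff hN hN' O
  exact ⟨p, ⟨hp, fun S hS => (hpS S).2 hS⟩, hp0⟩

theorem subSimplex_subset_cellFace_iff (hN : 0 < N) (hN' : N ≠ cleanRank G Finset.univ)
    {ρ σ : Finset (Fin n)} (O : PAO (G.induce (σ : Set (Fin n)))) :
    subSimplex N ρ ⊆ cellFace N O ↔ ρ ⊆ σᶜ := by
  constructor
  · intro h i hi
    have hmem := (single_mem_subSimplex_iff hN).2 hi
    have hsum := ((mem_subSimplex_iff hN).1 hmem).2.1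
    have h1 := (h hmem).2 σ (coe_mem_idealsIn O)
    rw [slack_of_height_eq_zero ((height_eq_zero_iff hN').2 hsum)] at h1
    rw [Finset.mem_compl]
    intro hiσ
    rw [Finset.sum_eq_single_of_mem i hiσ (fun j _ hj => by simp [hj])] at h1
    simp [hN.ne'] at h1
  · intro h x hx
    obtain ⟨h0, h1, h2⟩ := (mem_subSimplex_iff hN).1 hx
    refine ⟨dilatedSimplex_subset_joinPolyhedron hN hN' ((mem_dilatedSimplex_iff hN).2 ⟨h0, h1⟩),
      fun S hS => ?_⟩
    rw [slack_of_height_eq_zero ((height_eq_zero_iff hN').2 h1)]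
    refine Finset.sum_eq_zero fun i hi => h2 i fun hiρ => ?_
    exact Finset.mem_compl.1 (h hiρ) (((mem_idealsIn_iff O).1 hS).1 hi)

/-! ### The dimension of the faces -/

/-- The sums of a vector over the blocks of a partial acyclic orientation. -/
def blockSum {σ : Finset (Fin n)} (O : PAO (G.induce (σ : Set (Fin n)))) :
    (Fin n → ℝ) →ₗ[ℝ] (Quotient O.partition → ℝ) where
  toFun y b := by classical exact ∑ v : (σ : Set (Fin n)) with Quotient.mk O.partition v = b, y v
  map_add' x y := by ext b; simp [Finset.sum_add_distrib]
  map_smul' a y := by ext b; simp [Finset.mul_sum]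

theorem blockSum_surjective {σ : Finset (Fin n)} (O : PAO (G.induce (σ : Set (Fin n)))) :
    Function.Surjective (blockSum O) := by
  classical
  intro z
  -- Each value is placed at one representative of the block.
  refine ⟨fun i => if h : i ∈ (σ : Set (Fin n)) then
    if (Quotient.mk O.partition ⟨i, h⟩).out = ⟨i, h⟩ then z (Quotient.mk O.partition ⟨i, h⟩) else 0
    else 0, ?_⟩
  ext b
  simp only [blockSum, LinearMap.coe_mk, AddHom.coe_mk]
  rw [Finset.sum_eq_single_of_mem b.out (by simp)]
  · simp
  · intro v hv hne
    have hvb : Quotient.mk O.partition v = b := (Finset.mem_filter.1 hv).2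
    have : ¬ (Quotient.mk O.partition v).out = v := fun h => hne (by rw [← h, hvb])
    simp [this]

theorem blockSum_eq_zero_iff {σ : Finset (Fin n)} (O : PAO (G.induce (σ : Set (Fin n))))
    (y : Fin n → ℝ) : blockSum O y = 0 ↔
      ∀ S : Finset (Fin n), (S : Set (Fin n)) ∈ idealsIn O → ∑ i ∈ S, y i = 0 := by
  classical
  constructor
  · intro h S hS
    obtain ⟨W, ⟨I, -, rfl⟩, hI⟩ := hS
    have hsum : ∑ i ∈ S, y i = ∑ b with b ∈ I, blockSum O y b := by
      simp only [blockSum, LinearMap.coe_mk, AddHom.coe_mk]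
      rw [Finset.sum_comm' (t' := Finset.univ.filter fun v => Quotient.mk O.partition v ∈ I)
        (s' := fun v => {Quotient.mk O.partition v})]
      · simp only [Finset.sum_singleton]
        symm
        refine Finset.sum_bij (fun v _ => (v : Fin n)) ?_ (fun _ _ _ _ h => Subtype.ext h) ?_
          (fun _ _ => rfl)
        · intro v hv
          rw [← Finset.mem_coe, ← hI]
          exact ⟨v, (Finset.mem_filter.1 hv).2, rfl⟩
        · intro i hi
          rw [← Finset.mem_coe, ← hI] at hi
          obtain ⟨v, hv, rfl⟩ := hi
          exact ⟨v, Finset.mem_filter.2 ⟨Finset.mem_univ _, hv⟩, rfl⟩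
      · intro b v
        simp only [Finset.mem_filter, Finset.mem_univ, true_and, Finset.mem_singleton]
        constructor
        · rintro ⟨hb, rfl⟩
          exact ⟨rfl, hb⟩
        · rintro ⟨rfl, hb⟩
          exact ⟨hb, rfl⟩
    rw [hsum, h]
    simp
  · intro h
    ext b
    induction b using Quotient.inductionOn with | _ u =>
    -- The block of `u` is the difference of two ideals: the vertices from which `u` can be
    -- reached, and those among them that cannot be reached from `u`.
    let A : Finset (Fin n) := Finset.univ.filter fun i => ∃ hi, O.1.Reach ⟨i, hi⟩ u
    let B : Finset (Fin n) := Finset.univ.filter fun i => ∃ hi, O.1.Reach ⟨i, hi⟩ u ∧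
      ¬ O.1.Reach u ⟨i, hi⟩
    have hA : (A : Set (Fin n)) ∈ idealsIn O := by
      refine (mem_idealsIn_iff O).2 ⟨fun i hi => (Finset.mem_filter.1 hi).2.1, ?_⟩
      intro v w hvw hw hwv
      obtain ⟨-, _, hw⟩ := Finset.mem_filter.1 (show (w : Fin n) ∈ A from hw)
      show (v : Fin n) ∈ A
      exact Finset.mem_filter.2 ⟨Finset.mem_univ _, v.2, hw.head ⟨hvw, hwv⟩⟩
    have hB : (B : Set (Fin n)) ∈ idealsIn O := by
      refine (mem_idealsIn_iff O).2 ⟨fun i hi => (Finset.mem_filter.1 hi).2.1, ?_⟩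
      intro v w hvw hw hwv
      obtain ⟨-, _, hw, hw'⟩ := Finset.mem_filter.1 (show (w : Fin n) ∈ B from hw)
      show (v : Fin n) ∈ B
      exact Finset.mem_filter.2 ⟨Finset.mem_univ _, v.2, hw.head ⟨hvw, hwv⟩,
        fun huv => hw' (huv.tail ⟨hvw, hwv⟩)⟩
    have hBA : B ⊆ A := fun i hi => by
      obtain ⟨-, hi, h1, -⟩ := Finset.mem_filter.1 hi
      exact Finset.mem_filter.2 ⟨Finset.mem_univ _, hi, h1⟩
    have hdiff := Finset.sum_sdiff (f := y) hBA
    rw [h A hA, h B hB, add_zero] at hdiff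
    rw [Pi.zero_apply, ← hdiff]
    simp only [blockSum, LinearMap.coe_mk, AddHom.coe_mk]
    refine Finset.sum_bij (fun v _ => (v : Fin n)) ?_ (fun _ _ _ _ h => Subtype.ext h) ?_
      (fun _ _ => rfl)
    · intro v hv
      have hr : O.1.Reach v u ∧ O.1.Reach u v :=
        O.partition_rel_iff.1 (Quotient.exact (Finset.mem_filter.1 hv).2)
      refine Finset.mem_sdiff.2 ⟨Finset.mem_filter.2 ⟨Finset.mem_univ _, v.2, hr.1⟩, fun hB => ?_⟩
      obtain ⟨-, _, -, h'⟩ := Finset.mem_filter.1 hB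
      exact h' hr.2
    · intro i hi
      obtain ⟨hiA, hiB⟩ := Finset.mem_sdiff.1 hi
      obtain ⟨-, hiσ, h1⟩ := Finset.mem_filter.1 hiA
      have h2 : O.1.Reach u ⟨i, hiσ⟩ := by
        by_contra h2
        exact hiB (Finset.mem_filter.2 ⟨Finset.mem_univ _, hiσ, h1, h2⟩)
      exact ⟨⟨i, hiσ⟩, Finset.mem_filter.2 ⟨Finset.mem_univ _,
        Quotient.sound (O.partition_rel_iff.2 ⟨h1, h2⟩)⟩, rfl⟩

theorem affDim_cellFace (hN : 0 < N) (hN' : N ≠ cleanRank G Finset.univ)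
    {σ : Finset (Fin n)} (O : PAO (G.induce (σ : Set (Fin n)))) :
    affDim (cellFace N O) = (σᶜ).card + O.dim := by
  classical
  obtain ⟨p, hp, hp0, hpS⟩ := exists_slack_eq_zero_iff hN hN' O
  obtain ⟨z, hz, hzS⟩ := exists_mem_cleanZonotope_sum_eq O
  have hD : cleanRank G Finset.univ - N ≠ 0 := sub_ne_zero.2 hN'.symm
  -- With `z` as above, the linear part of the slack of an ideal `S` at `d` is the sum over `S` of
  -- the coordinates of `T d`, where `T` is invertible.
  let h : (Fin n → ℝ) →ₗ[ℝ] ℝ :=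
    (cleanRank G Finset.univ - N)⁻¹ • ∑ i, LinearMap.proj i
  have hh : ∀ d, h d = (∑ i, d i) / (cleanRank G Finset.univ - N) := fun d => by
    simp [h, div_eq_inv_mul]
  let T : (Fin n → ℝ) →ₗ[ℝ] (Fin n → ℝ) := LinearMap.id - h.smulRight z
  have hT : ∀ d i, T d i = d i - h d * z i := fun d i => by simp [T]
  have hTinj : Function.Injective T := by
    rw [injective_iff_map_eq_zero]
    intro d hd
    have h1 : ∑ i, T d i = 0 := by simp [hd]
    simp only [hT, Finset.sum_sub_distrib, ← Finset.mul_sum] at h1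
    rw [(mem_cleanZonotope_iff.1 hz).1, hh] at h1
    have h2 : (∑ i, d i) * N = 0 := by
      field_simp at h1
      linarith
    have h3 : h d = 0 := by
      rw [hh, (mul_eq_zero.1 h2).resolve_right hN.ne', zero_div]
    ext i
    have := hT d i
    rw [hd, h3] at this
    simpa using this.symm
  have hTsurj : Function.Surjective T := LinearMap.injective_iff_surjective.1 hTinj
  have hspan : vectorSpan ℝ (cellFace N O) = (blockSum O ∘ₗ T).ker := by
    ext d
    rw [cellFace_eq_polyFace hp0 hpS, mem_vectorSpan_polyFace_tightAt hp, Option.forall,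
      none_mem_tightAt, and_iff_right fun h => absurd h hp0.ne', LinearMap.mem_ker,
      LinearMap.comp_apply, blockSum_eq_zero_iff]
    refine forall_congr' fun S => ?_
    rw [some_mem_tightAt, hpS]
    refine imp_congr_right fun hS => ?_
    simp only [hT, Finset.sum_sub_distrib, ← Finset.mul_sum]
    rw [hzS S hS, joinForm_some, hh, mul_comm]
  have hrank := (blockSum O ∘ₗ T).finrank_range_add_finrank_ker
  have hsurj : Function.Surjective (blockSum O ∘ₗ T) := by
    rw [LinearMap.coe_comp]
    exact (blockSum_surjective O).comp hTsurj
  rw [LinearMap.range_eq_top.2 hsurj, finrank_top,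
    Module.finrank_fintype_fun_eq_card, Module.finrank_fin_fun, ← hspan] at hrank
  have h1 : Nat.card (Quotient O.partition) ≤ Nat.card (σ : Set (Fin n)) :=
    Nat.card_le_card_of_surjective _ Quotient.mk_surjective
  have h2 : Nat.card (σ : Set (Fin n)) = σ.card := by simp
  have h3 := Finset.card_add_card_compl σ
  rw [Fintype.card_fin] at h3
  rw [← Nat.card_eq_fintype_card] at hrank
  rw [affDim, PAO.dim]
  omega

/-! ### The classification of the faces -/

theorem subSimplex_eq_polyFace (hN : 0 < N) (hN' : N ≠ cleanRank G Finset.univ)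
    (ρ : Finset (Fin n)) :
    subSimplex N ρ = polyFace (joinForm G N) (joinBound G N)
      (insert none ((fun i : Fin n => some {i}) '' {i | i ∉ ρ})) := by
  ext x
  simp only [polyFace, Set.forall_mem_insert, Set.forall_mem_image, joinForm_none_eq_iff,
    joinForm_some_eq_iff, Set.mem_ofPred_eq]
  rw [mem_subSimplex_iff hN]
  constructor
  · rintro ⟨h0, h1, h2⟩
    have hh := (height_eq_zero_iff hN').2 h1
    refine ⟨dilatedSimplex_subset_joinPolyhedron hN hN' ((mem_dilatedSimplex_iff hN).2 ⟨h0, h1⟩),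
      hh, fun i hi => ?_⟩
    rw [slack_of_height_eq_zero hh, Finset.sum_singleton, h2 i hi]
  · rintro ⟨hx, hh, h2⟩
    have hs : ∀ i, slack G N {i} x = x i := fun i => by
      rw [slack_of_height_eq_zero hh, Finset.sum_singleton]
    refine ⟨fun i => ?_, (height_eq_zero_iff hN').1 hh, fun i hi => ?_⟩
    · rw [← hs i]
      exact (mem_joinPolyhedron_iff.1 hx).2 {i}
    · rw [← hs i]
      exact h2 hi

theorem isFace_subSimplex (hN : 0 < N) (hN' : N ≠ cleanRank G Finset.univ)
    {ρ : Finset (Fin n)} (hρ : ρ.Nonempty) :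
    IsFace (polyhedron (joinForm G N) (joinBound G N)) (subSimplex N ρ) := by
  have h := subSimplex_nonempty (N := N) hρ
  rw [subSimplex_eq_polyFace hN hN'] at h ⊢
  exact isFace_polyFace h

theorem height_eq_zero_of_mem_subSimplex (hN : 0 < N) (hN' : N ≠ cleanRank G Finset.univ)
    {ρ : Finset (Fin n)} {x : Fin n → ℝ} (hx : x ∈ subSimplex N ρ) : height G N x = 0 :=
  (height_eq_zero_iff hN').2 ((mem_subSimplex_iff hN).1 hx).2.1

/-- The vertex sets whose slack vanishes at a point off the simplex are the ideals of a partial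
acyclic orientation. -/
theorem exists_pao_of_height_pos {p : Fin n → ℝ}
    (hp : p ∈ polyhedron (joinForm G N) (joinBound G N)) (hp0 : 0 < height G N p) :
    ∃ (σ : Finset (Fin n)) (O : PAO (G.induce (σ : Set (Fin n)))),
      ∀ S : Finset (Fin n), slack G N S p = 0 ↔ (S : Set (Fin n)) ∈ idealsIn O := by
  have hS := (mem_joinPolyhedron_iff.1 hp).2
  have hcross : ∀ S T, 0 ≤ height G N p * crossEdges G (S \ T) (T \ S) := fun S T =>
    mul_nonneg hp0.le (crossEdges_nonneg _ _ _)
  have hlat : ∀ S T, slack G N S p = 0 → slack G N T p = 0 → slack G N (S ∪ T) p = 0 ∧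
      slack G N (S ∩ T) p = 0 ∧ crossEdges G (S \ T) (T \ S) = 0 := by
    intro S T h1 h2
    have h := slack_add_slack (G := G) (N := N) p S T
    have h3 := hS (S ∪ T)
    have h4 := hS (S ∩ T)
    have h5 := hcross S T
    rw [h1, h2] at h
    exact ⟨by linarith, by linarith,
      (mul_eq_zero.1 (show height G N p * crossEdges G (S \ T) (T \ S) = 0 by
        linarith)).resolve_left hp0.ne'⟩
  obtain ⟨σ, O, hO⟩ := exists_pao_of_lattice (G := G) {S | slack G N S p = 0} (slack_empty p)
    (fun S h1 T h2 => (hlat S T h1 h2).1) (fun S h1 T h2 => (hlat S T h1 h2).2.1)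
    (fun S h1 T h2 => (crossEdges_eq_zero_iff _ _ _).1 (hlat S T h1 h2).2.2)
    (fun X Y (h1 : slack G N (X ∪ Y) p = 0) (h2 : slack G N (X ∩ Y) p = 0) h3 => by
      have h := slack_add_slack (G := G) (N := N) p X Y
      rw [h1, h2, (crossEdges_eq_zero_iff _ _ _).2 h3, mul_zero] at h
      have h4 := hS X
      have h5 := hS Y
      show slack G N X p = 0
      linarith)
  exact ⟨σ, O, fun S => (hO S).symm⟩

theorem IsFace.eq_subSimplex_or_eq_cellFace (hN : 0 < N) (hN' : N ≠ cleanRank G Finset.univ)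
    {F : Set (Fin n → ℝ)} (h : IsFace (polyhedron (joinForm G N) (joinBound G N)) F) :
    (∃ ρ : Finset (Fin n), ρ.Nonempty ∧ F = subSimplex N ρ) ∨
      ∃ (σ : Finset (Fin n)) (O : PAO (G.induce (σ : Set (Fin n)))), F = cellFace N O := by
  classical
  obtain ⟨p, hpF, hF⟩ := h.exists_eq_polyFace
  have hp := h.subset hpF
  rcases (mem_joinPolyhedron_iff.1 hp).1.eq_or_lt' with hp0 | hp0
  · left
    have hs : ∀ S, slack G N S p = ∑ i ∈ S, p i := slack_of_height_eq_zero hp0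
    have hpos : ∀ i, 0 ≤ p i := fun i => by
      have := (mem_joinPolyhedron_iff.1 hp).2 {i}
      rwa [hs, Finset.sum_singleton] at this
    have hFρ : F = subSimplex N (Finset.univ.filter fun i => p i ≠ 0) := by
      rw [subSimplex_eq_polyFace (G := G) hN hN']
      refine Set.Subset.antisymm ?_ ?_
      · rw [hF]
        refine polyFace_anti (Set.insert_subset (none_mem_tightAt.2 hp0) ?_)
        rintro _ ⟨i, hi, rfl⟩
        rw [some_mem_tightAt, hs, Finset.sum_singleton]
        simpa using hi
      · rw [← subSimplex_eq_polyFace hN hN']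
        intro x hx
        have hx0 := height_eq_zero_of_mem_subSimplex hN hN' hx
        obtain ⟨h0, h1, h2⟩ := (mem_subSimplex_iff hN).1 hx
        rw [hF]
        refine ⟨dilatedSimplex_subset_joinPolyhedron hN hN'
          ((mem_dilatedSimplex_iff hN).2 ⟨h0, h1⟩), ?_⟩
        rintro (_ | S) hS
        · exact joinForm_none_eq_iff.2 hx0
        · rw [joinForm_some_eq_iff, slack_of_height_eq_zero hx0]
          rw [some_mem_tightAt, hs, Finset.sum_eq_zero_iff_of_nonneg fun i _ => hpos i] at hS
          exact Finset.sum_eq_zero fun i hi => h2 i (by simp [hS i hi])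
    refine ⟨_, ?_, hFρ⟩
    by_contra hne
    rw [Finset.not_nonempty_iff_eq_empty] at hne
    rw [hne] at hFρ
    rw [hFρ] at hpF
    simp [subSimplex] at hpF
  · right
    obtain ⟨σ, O, hO⟩ := exists_pao_of_height_pos hp hp0
    exact ⟨σ, O, by rw [hF, cellFace_eq_polyFace hp0 hO]⟩

theorem cellFace_empty (O : PAO (G.induce ((∅ : Finset (Fin n)) : Set (Fin n)))) :
    cellFace N O = polyhedron (joinForm G N) (joinBound G N) := by
  refine Set.Subset.antisymm (fun x hx => hx.1) fun x hx => ⟨hx, fun S hS => ?_⟩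
  have : S = ∅ := by
    have h := ((mem_idealsIn_iff O).1 hS).1
    rwa [Finset.coe_subset, Finset.subset_empty] at h
  rw [this, slack_empty]

theorem exists_cellFace_eq_polyhedron (G : SimpleGraph (Fin n)) (N : ℝ) :
    ∃ O : PAO (G.induce ((∅ : Finset (Fin n)) : Set (Fin n))),
      cellFace N O = polyhedron (joinForm G N) (joinBound G N) :=
  ⟨⟨undirected _, (undirected _).exists_obtainedFrom fun _ _ h => h.elim⟩, cellFace_empty _⟩

theorem affDim_joinPolyhedron (hN : 0 < N) (hN' : N ≠ cleanRank G Finset.univ) :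
    affDim (polyhedron (joinForm G N) (joinBound G N)) = n := by
  obtain ⟨O, hO⟩ := exists_cellFace_eq_polyhedron G N
  rw [← hO, affDim_cellFace hN hN', PAO.dim]
  simp

/-! ### The realization of the abstract complex -/

/-- The face of the join that corresponds to a cell of the abstract complex. -/
def YCell.face (N : ℝ) : YCell G → Set (Fin n → ℝ)
  | .pair _ _ O => cellFace N O
  | .subset ρ _ _ => subSimplex N ρ

theorem YCell.face_injective (hN : 0 < N) (hN' : N ≠ cleanRank G Finset.univ) :
    Function.Injective (YCell.face (G := G) N) := by
  rintro (⟨σ, hσ, O⟩ | ⟨ρ, hρ, hρ'⟩) (⟨τ, hτ, O'⟩ | ⟨π, hπ, hπ'⟩) h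
  · have h : cellFace N O = cellFace N O' := h
    exact eq_of_idealsIn_eq (((cellFace_subset_cellFace_iff hN hN' O' O).1 h.ge).antisymm
      ((cellFace_subset_cellFace_iff hN hN' O O').1 h.le))
  · have h : cellFace N O = subSimplex N π := h
    obtain ⟨p, hp, hp0⟩ := exists_mem_cellFace_height_pos hN hN' O
    exact absurd (height_eq_zero_of_mem_subSimplex hN hN' (h ▸ hp)) hp0.ne'
  · have h : subSimplex N ρ = cellFace N O' := h
    obtain ⟨p, hp, hp0⟩ := exists_mem_cellFace_height_pos hN hN' O'
    exact absurd (height_eq_zero_of_mem_subSimplex hN hN' (h ▸ hp)) hp0.ne'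
  · have h : subSimplex N ρ = subSimplex N π := h
    obtain rfl : ρ = π :=
      ((subSimplex_subset_iff hN).1 h.le).antisymm ((subSimplex_subset_iff hN).1 h.ge)
    rfl

theorem YCell.le_iff (hN : 0 < N) (hN' : N ≠ cleanRank G Finset.univ) (A B : YCell G) :
    A.le B ↔ A.face N ⊆ B.face N := by
  have hrel : A.rel B ↔ A.face N ⊆ B.face N := by
    rcases A with (⟨σ, hσ, O⟩ | ⟨ρ, hρ, hρ'⟩) <;> rcases B with (⟨τ, hτ, O'⟩ | ⟨π, hπ, hπ'⟩)
    · exact (cellFace_subset_cellFace_iff hN hN' O O').symm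
    · refine ⟨fun h => h.elim, fun h => ?_⟩
      obtain ⟨p, hp, hp0⟩ := exists_mem_cellFace_height_pos hN hN' O
      exact hp0.ne' (height_eq_zero_of_mem_subSimplex hN hN' (h hp))
    · exact (subSimplex_subset_cellFace_iff hN hN' O').symm
    · exact (subSimplex_subset_iff hN).symm
  refine ⟨fun h => h.elim (fun h => h ▸ subset_rfl) hrel.1, fun h => .inr (hrel.2 h)⟩

theorem YCell.affDim_face (hN : 0 < N) (hN' : N ≠ cleanRank G Finset.univ) (A : YCell G) :
    affDim (A.face N) = A.dim := by
  rcases A with (⟨σ, hσ, O⟩ | ⟨ρ, hρ, hρ'⟩)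
  · exact affDim_cellFace hN hN' O
  · exact affDim_subSimplex hN hρ

theorem YCell.isFace_face (hN : 0 < N) (hN' : N ≠ cleanRank G Finset.univ) (A : YCell G) :
    IsFace (polyhedron (joinForm G N) (joinBound G N)) (A.face N) := by
  rcases A with (⟨σ, hσ, O⟩ | ⟨ρ, hρ, hρ'⟩)
  · exact isFace_cellFace hN hN' O
  · exact isFace_subSimplex hN hN' hρ

theorem isAbstractCellComplex_YCell (hN : 0 < N) (hN' : N ≠ cleanRank G Finset.univ) :
    IsAbstractCellComplex (YCell.le (G := G)) (YCell.dim (G := G)) := by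
  have hle := YCell.le_iff (G := G) hN hN'
  refine ⟨fun A => .inl rfl, fun A B hAB hBA => ?_, fun A B C hAB hBC => ?_,
    fun A B hAB hne => ?_⟩
  · exact YCell.face_injective hN hN' (((hle A B).1 hAB).antisymm ((hle B A).1 hBA))
  · exact (hle A C).2 (((hle A B).1 hAB).trans ((hle B C).1 hBC))
  · rw [← YCell.affDim_face hN hN', ← YCell.affDim_face hN hN']
    by_contra hlt
    exact hne (YCell.face_injective hN hN' ((A.isFace_face hN hN').eq_of_subset_of_affDim_le
      (B.isFace_face hN hN').subset ((hle A B).1 hAB) (not_lt.1 hlt)))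

theorem mem_complexY_iff (hn : 0 < n) (hN : 0 < N) (hN' : N ≠ cleanRank G Finset.univ)
    (F : Set (Fin n → ℝ)) : F ∈ complexY G N ↔ ∃ A : YCell G, A.face N = F := by
  obtain ⟨O₀, hO₀⟩ := exists_cellFace_eq_polyhedron G N
  obtain ⟨p₀, hp₀, hp₀'⟩ := exists_mem_cellFace_height_pos hN hN' O₀
  rw [complexY, Set.mem_ofPred_eq, zonoJoin_eq_polyhedron hn hN hN', ← subSimplex_univ]
  constructor
  · rintro ⟨hF, h1, h2⟩
    rcases hF.eq_subSimplex_or_eq_cellFace hN hN' with ⟨ρ, hρ, rfl⟩ | ⟨σ, O, rfl⟩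
    · exact ⟨.subset ρ hρ fun h => h2 (by rw [h]), rfl⟩
    · have hσ : σ.Nonempty := by
        rw [Finset.nonempty_iff_ne_empty]
        rintro rfl
        exact h1 (cellFace_empty O)
      exact ⟨.pair σ hσ O, rfl⟩
  · rintro ⟨A, rfl⟩
    refine ⟨A.isFace_face hN hN', ?_⟩
    rcases A with (⟨σ, hσ, O⟩ | ⟨ρ, hρ, hρ'⟩)
    · refine ⟨fun h => ?_, fun h => ?_⟩
      · have h : cellFace N O = _ := h
        have hsub := (cellFace_subset_cellFace_iff hN hN' O₀ O).1 (hO₀.trans h.symm).le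
        have := ((mem_idealsIn_iff O₀).1 (hsub (coe_mem_idealsIn O))).1
        rw [Finset.coe_subset, Finset.subset_empty] at this
        exact hσ.ne_empty this
      · have h : cellFace N O = _ := h
        obtain ⟨p, hp, hp0⟩ := exists_mem_cellFace_height_pos hN hN' O
        exact hp0.ne' (height_eq_zero_of_mem_subSimplex hN hN' (h ▸ hp))
    · refine ⟨fun h => ?_, fun h => ?_⟩
      · have h : subSimplex N ρ = _ := h
        rw [hO₀, ← h] at hp₀
        exact hp₀'.ne' (height_eq_zero_of_mem_subSimplex hN hN' hp₀)
      · exact hρ' (Finset.univ_subset_iff.1 ((subSimplex_subset_iff hN).1 h.ge))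

theorem isPolytopalComplex_complexY (hn : 0 < n) (hN : 0 < N)
    (hN' : N ≠ cleanRank G Finset.univ) : IsPolytopalComplex (complexY G N) := by
  have hP := zonoJoin_eq_polyhedron (G := G) hn hN hN'
  have hface : ∀ F ∈ complexY G N, IsFace (polyhedron (joinForm G N) (joinBound G N)) F :=
    fun F hF => hP ▸ hF.1
  refine ⟨finite_setOf_isFace.subset hface, fun F hF => hF.1.1,
    fun F hF => (hface F hF).isPolytope (isCompact_joinPolyhedron hN hN'), ?_,
    fun F hF F' hF' hne => hF.1.inter hF'.1 hne⟩
  intro F hF F' hF'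
  refine ⟨hP ▸ (hface F hF).trans hF', fun h => ?_, fun h => ?_⟩
  · exact hF.2.1 (hF.1.subset.antisymm (h ▸ hF'.subset))
  · -- The simplex has codimension one, so that no face lies strictly between it and the join.
    have hne : (Finset.univ : Finset (Fin n)).Nonempty := ⟨⟨0, hn⟩, Finset.mem_univ _⟩
    have hd : affDim F' = n - 1 := by
      rw [h, ← subSimplex_univ, affDim_subSimplex hN hne, Finset.card_univ, Fintype.card_fin]
    have hn' := affDim_joinPolyhedron (G := G) hN hN'
    have h1 : ¬ affDim F ≤ affDim F' := fun hle => hF.2.2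
      ((((hface F hF).trans hF').eq_of_subset_of_affDim_le (hface F hF).subset hF'.subset
        hle).symm.trans h)
    have h2 : ¬ affDim (polyhedron (joinForm G N) (joinBound G N)) ≤ affDim F := fun hle =>
      hF.2.1 (((hface F hF).eq_of_subset_of_affDim_le subset_rfl (hface F hF).subset hle).trans
        hP.symm)
    omega

theorem isRealization_complexY (hn : 0 < n) (hN : 0 < N) (hN' : N ≠ cleanRank G Finset.univ) :
    IsRealization (complexY G N) (YCell.le (G := G)) (YCell.dim (G := G)) := by
  refine ⟨isPolytopalComplex_complexY hn hN hN', ?_⟩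
  let f : YCell G → complexY G N := fun A =>
    ⟨A.face N, (mem_complexY_iff hn hN hN' _).2 ⟨A, rfl⟩⟩
  have hf : Function.Bijective f := by
    refine ⟨fun A B h => YCell.face_injective hN hN' (congrArg Subtype.val h), ?_⟩
    rintro ⟨F, hF⟩
    obtain ⟨A, rfl⟩ := (mem_complexY_iff hn hN hN' F).1 hF
    exact ⟨A, rfl⟩
  exact ⟨Equiv.ofBijective f hf, YCell.le_iff hN hN', YCell.affDim_face hN hN'⟩

end GraphZono

end

theorem mainTheorem3 (n : ℕ) (G : SimpleGraph (Fin n)) (hG : G.Connected) (N : ℝ) (hN : 0 < N)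
    (hN' : N ≠ (n : ℝ) + (G.edgeSet.ncard : ℝ)) :
    (GraphZono.IsPolytope (GraphZono.zonoJoin G N) ∧
      GraphZono.affDim (GraphZono.zonoJoin G N) = n ∧
      GraphZono.IsFace (GraphZono.zonoJoin G N) (GraphZono.dilatedSimplex n N) ∧
      GraphZono.affDim (GraphZono.dilatedSimplex n N) = n - 1) ∧
    GraphZono.IsAbstractCellComplex (GraphZono.YCell.le (G := G)) (GraphZono.YCell.dim (G := G)) ∧
    GraphZono.IsRealization (GraphZono.complexY G N)
      (GraphZono.YCell.le (G := G)) (GraphZono.YCell.dim (G := G)) := by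
  rw [← GraphZono.cleanRank_univ] at hN'
  obtain ⟨i⟩ := hG.nonempty
  have hn : 0 < n := i.pos
  have hne : (Finset.univ : Finset (Fin n)).Nonempty := ⟨i, Finset.mem_univ _⟩
  have hsimplex := GraphZono.isFace_subSimplex hN hN' hne
  have hdim := GraphZono.affDim_subSimplex hN hne
  rw [Finset.card_univ, Fintype.card_fin] at hdim
  rw [GraphZono.subSimplex_univ] at hsimplex hdim
  refine ⟨?_, GraphZono.isAbstractCellComplex_YCell hN hN',
    GraphZono.isRealization_complexY hn hN hN'⟩
  rw [GraphZono.zonoJoin_eq_polyhedron hn hN hN']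
  exact ⟨(GraphZono.isFace_self (hsimplex.1.mono hsimplex.subset)).isPolytope
    (GraphZono.isCompact_joinPolyhedron hN hN'), GraphZono.affDim_joinPolyhedron hN hN',
    hsimplex, hdim⟩
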